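/- Let $A\in\mathbb R^{n\times n}$, $b,c,k\in\mathbb R^n$, let $\varphi_0:\mathbb R\to\mathbb R^n$ and $\varphi:\mathbb R\to\mathbb R^m$ be continuous (hence bounded on bounded sets), and consider the master system $$\dot x=Ax+\varphi_0(y)+b\,\varphi(y)^T\theta,\qquad y=c^Tx,\qquad(1)$$ with constant parameter $\theta\in\mathbb R^m$. Assume that for every $\theta\in\mathbb R^m$ and every initial state $x(0)$ system (1) has a solution on $[0,\infty)$ and that every such solution is bounded. Assume that $F=A-kc^T$ is Hurwitz, and put $H(p)=c^T(pI-F)^{-1}b$; for a scalar signal $u$, $H(p)[u]$ denotes $c^Tz$, where $\dot z=Fz+bu$ with arbitrary initial state $z(0)$. Write $\varphi(t)=\varphi(y(t))$. The closed loop consists of (1), the observer $$\dot{\hat x}=A\hat x+\varphi_0(y)+b\,\varphi(y)^T\hat\theta+k(y-\hat y),\qquad \hat y=c^T\hat x,$$ and the adaptation law $$\dot{\hat\theta}=\gamma\,\hat e\,\omega,\qquad \omega=H(p)[\varphi(t)]\ \text{(componentwise)},\qquad \hat e=(y-\hat y)+H(p)\big[\varphi(t)^T\hat\theta\big]-\omega^T\hat\theta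 .$$ Then, for every $\gamma>0$ and every $\theta\in\mathbb R^m$: (i) for all initial conditions (of $x$, $\hat x$, $\hat\theta$ and of the states of the filters $H(p)$) the closed loop has a solution on $[0,\infty)$, and along every such solution all signals (the states $x,\hat x,\hat\theta$, the filter states, and $y$, $\hat y$, $\varphi_0(y)$, $\varphi(y)$, $\omega$, $H(p)[\varphi^T\hat\theta]$, $\hat e$) are bounded on $[0,\infty)$ and $\lim_{t\to\infty}(y(t)-\hat y(t))=0$; (ii) if along the solution $\varphi(t)$ is persistently exciting, i.e. it is measurable and bounded on $[0,\infty)$ and there are $\alpha,T>0$ with $\int_t^{t+T}\varphi(s)\varphi(s)^T\,ds\ge\alpha I$ for all $t\ge0$, and if $H$ is minimum phase, i.e. all its finite zeros lie in the open left half-plane (in particular $H\not\equiv0$), then in addition $\lim_{t\to\infty}|\theta-\hat\theta(t)|=0$. -/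

import Mathlib

open Set Filter Topology Matrix

/-- Data of the master system `x' = A x + φ₀(y) + b φ(y)ᵀ θ`, `y = cᵀ x`. -/
structure Plant (n m : ℕ) where
  A : Matrix (Fin n) (Fin n) ℝ
  b : Fin n → ℝ
  c : Fin n → ℝ
  φ₀ : ℝ → Fin n → ℝ
  φ : ℝ → Fin m → ℝ

/-- A signal on `[0, ∞)` is bounded (values at negative times are irrelevant). -/
def BoundedSignal {E : Type*} [Norm E] (f : ℝ → E) : Prop :=
  ∃ M : ℝ, ∀ t : ℝ, 0 ≤ t → ‖f t‖ ≤ M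

/-- `x` solves `x' = A x + φ₀(y) + b φ(y)ᵀ θ`, `y = cᵀ x` on `[0, ∞)`
(one-sided derivative at `0`). -/
def Plant.IsMasterSolution {n m : ℕ} (P : Plant n m) (θ : Fin m → ℝ)
    (x : ℝ → Fin n → ℝ) : Prop :=
  ∀ t : ℝ, 0 ≤ t →
    HasDerivWithinAt x
      (P.A *ᵥ x t + P.φ₀ (P.c ⬝ᵥ x t) + (P.φ (P.c ⬝ᵥ x t) ⬝ᵥ θ) • P.b) (Ici 0) t

/-- For every parameter value and every initial state the master system has a solution on
`[0, ∞)`, and every such solution is bounded. -/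
def Plant.HasBoundedStates {n m : ℕ} (P : Plant n m) : Prop :=
  ∀ (θ : Fin m → ℝ) (x₀ : Fin n → ℝ),
    (∃ x : ℝ → Fin n → ℝ, P.IsMasterSolution θ x ∧ x 0 = x₀) ∧
    ∀ x : ℝ → Fin n → ℝ, P.IsMasterSolution θ x → x 0 = x₀ → BoundedSignal x

/-- `F = A - k cᵀ`. -/
def Plant.F {n m : ℕ} (P : Plant n m) (k : Fin n → ℝ) : Matrix (Fin n) (Fin n) ℝ :=
  P.A - vecMulVec k P.c

/-- All complex eigenvalues have negative real part. -/
def IsHurwitz {n : ℕ} (F : Matrix (Fin n) (Fin n) ℝ) : Prop :=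
  ∀ s ∈ spectrum ℂ (F.map (algebraMap ℝ ℂ)), s.re < 0

/-- The transfer function `H(s) = cᵀ (s I - F)⁻¹ b`, meaningful off the spectrum of `F`. -/
noncomputable def transferFunction {n : ℕ} (F : Matrix (Fin n) (Fin n) ℝ) (b c : Fin n → ℝ)
    (s : ℂ) : ℂ :=
  (fun i => (c i : ℂ)) ⬝ᵥ
    ((s • (1 : Matrix (Fin n) (Fin n) ℂ) - F.map (algebraMap ℝ ℂ))⁻¹ *ᵥ fun i => (b i : ℂ))

/-- Minimum phase: all (finite) zeros of `H` lie in the open left half plane; in particular `H`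
is not identically zero. To be used for Hurwitz `F`, when `H` has no pole in `Re s ≥ 0`. -/
def IsMinimumPhase {n : ℕ} (F : Matrix (Fin n) (Fin n) ℝ) (b c : Fin n → ℝ) : Prop :=
  ∀ s : ℂ, transferFunction F b c s = 0 → s.re < 0

/-- `z` is a state of the filter `z' = F z + b u` on `[0, ∞)`, with any initial value. The filter
output `H(p)[u]` is `cᵀ z`. -/
def IsFilterState {n : ℕ} (F : Matrix (Fin n) (Fin n) ℝ) (b : Fin n → ℝ)
    (u : ℝ → ℝ) (z : ℝ → Fin n → ℝ) : Prop :=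
  ∀ t : ℝ, 0 ≤ t → HasDerivWithinAt z (F *ᵥ z t + u t • b) (Ici 0) t

/-- Persistent excitation on `[0, ∞)`: measurable, bounded, and
`∫_t^{t+T} f fᵀ ≥ α I` for some `α, T > 0` and all `t ≥ 0`. -/
def PersistentlyExciting {m : ℕ} (f : ℝ → Fin m → ℝ) : Prop :=
  Measurable (fun t : Ici (0 : ℝ) => f t) ∧ BoundedSignal f ∧
  ∃ α T : ℝ, 0 < α ∧ 0 < T ∧ ∀ t : ℝ, 0 ≤ t →
    ((Matrix.of fun i j : Fin m => ∫ s in t..(t + T), f s i * f s j) -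
      α • (1 : Matrix (Fin m) (Fin m) ℝ)).PosSemidef

/-- The state signals of the closed loop: master state `x`, observer state `xhat`, parameter
estimate `θhat`, state `Ω i` of the filter producing `ω i = H(p)[φ i]`, and state `ζ` of the
filter producing `H(p)[φᵀ θhat]`. -/
structure Signals (n m : ℕ) where
  x : ℝ → Fin n → ℝ
  xhat : ℝ → Fin n → ℝ
  θhat : ℝ → Fin m → ℝ
  Ω : Fin m → ℝ → Fin n → ℝ
  ζ : ℝ → Fin n → ℝ

namespace Signals

variable {n m : ℕ}

/-- Master output `y = cᵀ x`. -/
def y (P : Plant n m) (S : Signals n m) (t : ℝ) : ℝ := P.c ⬝ᵥ S.x t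

/-- Observer output `ŷ = cᵀ x̂`. -/
def yhat (P : Plant n m) (S : Signals n m) (t : ℝ) : ℝ := P.c ⬝ᵥ S.xhat t

/-- Output error `e = y - ŷ`. -/
def e (P : Plant n m) (S : Signals n m) (t : ℝ) : ℝ := S.y P t - S.yhat P t

/-- Regressor `φ(t) = φ(y(t))`. -/
def regressor (P : Plant n m) (S : Signals n m) (t : ℝ) : Fin m → ℝ := P.φ (S.y P t)

/-- Filtered regressor `ω = H(p)[φ(t)]`. -/
def ω (P : Plant n m) (S : Signals n m) (t : ℝ) : Fin m → ℝ := fun i => P.c ⬝ᵥ S.Ω i t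

/-- The signal `H(p)[φ(t)ᵀ θhat]`. -/
def χ (P : Plant n m) (S : Signals n m) (t : ℝ) : ℝ := P.c ⬝ᵥ S.ζ t

/-- Augmented error `ê = e + H(p)[φᵀ θhat] - ωᵀ θhat`. -/
def ehat (P : Plant n m) (S : Signals n m) (t : ℝ) : ℝ :=
  S.e P t + S.χ P t - S.ω P t ⬝ᵥ S.θhat t

/-- The signals satisfy, on `[0, ∞)`, the master system, the observer, the two filter equations
and the adaptation law. -/
structure IsClosedLoop (P : Plant n m) (k : Fin n → ℝ) (γ : ℝ) (θ : Fin m → ℝ)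
    (S : Signals n m) : Prop where
  master : P.IsMasterSolution θ S.x
  observer : ∀ t : ℝ, 0 ≤ t →
    HasDerivWithinAt S.xhat
      (P.A *ᵥ S.xhat t + P.φ₀ (S.y P t) + (P.φ (S.y P t) ⬝ᵥ S.θhat t) • P.b +
        (S.y P t - S.yhat P t) • k) (Ici 0) t
  filterΩ : ∀ i : Fin m, IsFilterState (P.F k) P.b (fun t => S.regressor P t i) (S.Ω i)
  filterζ : IsFilterState (P.F k) P.b (fun t => S.regressor P t ⬝ᵥ S.θhat t) S.ζ
  adaptation : ∀ t : ℝ, 0 ≤ t →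
    HasDerivWithinAt S.θhat ((γ * S.ehat P t) • S.ω P t) (Ici 0) t

/-- All signals of the loop are bounded on `[0, ∞)`. -/
structure AllBounded (P : Plant n m) (S : Signals n m) : Prop where
  x : BoundedSignal S.x
  xhat : BoundedSignal S.xhat
  θhat : BoundedSignal S.θhat
  Ω : ∀ i : Fin m, BoundedSignal (S.Ω i)
  ζ : BoundedSignal S.ζ
  y : BoundedSignal (S.y P)
  yhat : BoundedSignal (S.yhat P)
  e : BoundedSignal (S.e P)
  φ₀ : BoundedSignal (fun t => P.φ₀ (S.y P t))
  regressor : BoundedSignal (S.regressor P)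
  ω : BoundedSignal (S.ω P)
  χ : BoundedSignal (S.χ P)
  ehat : BoundedSignal (S.ehat P)

end Signals

/-! Write p = θ - θhat. The observation error x - x̂ is a state of the filter H driven by φᵀp.
Adding the filter state of H[φᵀθhat] and subtracting the θ-combination of the regressor filter
states cancels all inputs, so this `mismatch` decays exponentially. Hence ê = d + ωᵀp with d
exponentially small, and adaptation is the perturbed gradient law p' = -γ(d + ωᵀp)ω.

Up to an exponentially small correction |p|² is nonincreasing, so p is bounded and |p|² converges.
Barbalat's lemma applied to |p|² gives ωᵀp → 0, hence ê → 0 and θhat' → 0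
(`tendsto_prediction_error_gradient`). The swapping term H[φᵀθhat] - ωᵀθhat is the output of a
stable filter whose input is linear in θhat', so it vanishes too, and with it y - ŷ
(`tendsto_output_error`).

For (ii), y - ŷ = H[φᵀp] → 0 with φᵀp bounded and uniformly continuous. Minimum phase allows H to be
inverted asymptotically, giving φᵀp → 0 (`tendsto_input_of_tendsto_output`). As p' → 0, p is nearly
constant on each excitation window, and persistent excitation forces p → 0.

Existence uses the triangular structure: x solves an autonomous equation, then come the regressor
filters, the mismatch, p (an affine equation with bounded coefficients), ζ, and finally x̂
algebraically.

Stability of matrix filters is reduced to complex scalar filters w' = lw + g by factoring the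
characteristic polynomial. -/

/-- A signal that decays at least exponentially on `[0, ∞)`. -/
def ExpDecaying {E : Type*} [Norm E] (f : ℝ → E) : Prop :=
  ∃ M μ : ℝ, 0 < μ ∧ ∀ t : ℝ, 0 ≤ t → ‖f t‖ ≤ M * Real.exp (-μ * t)

/-! ### First order complex filters w' = lw + g with Re l < 0. -/

section ScalarFilter

variable {V : Type*} [NormedAddCommGroup V] [NormedSpace ℝ V] [NormedSpace ℂ V]
  [IsScalarTower ℝ ℂ V]

/-- Duhamel estimate for `w' = l w + g` with an exponentially bounded input. -/
theorem norm_le_of_hasDerivWithinAt_smul_add {l : ℂ} {w g : ℝ → V} {T μ M : ℝ} (hT : 0 ≤ T)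
    (hμ : μ < -l.re)
    (hw : ∀ t : ℝ, 0 ≤ t → HasDerivWithinAt w (l • w t + g t) (Ici 0) t)
    (hg : ∀ t : ℝ, T ≤ t → ‖g t‖ ≤ M * Real.exp (-μ * (t - T))) {t : ℝ} (ht : T ≤ t) :
    ‖w t‖ ≤ Real.exp (l.re * (t - T)) * ‖w T‖ +
      M / (-l.re - μ) * Real.exp (-μ * (t - T)) := by
  have ha : 0 < -l.re - μ := by linarith
  have hM : 0 ≤ M := by
    have := (norm_nonneg _).trans (hg T le_rfl)
    simpa using this
  -- The integrating factor removes the term `l • w`, so W' is the rescaled input and only its norm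
  -- needs to be integrated.
  set W : ℝ → V := fun s => Complex.exp (-l * ((s - T : ℝ) : ℂ)) • w s with hWdef
  have hnexp : ∀ s : ℝ, ‖Complex.exp (-l * ((s - T : ℝ) : ℂ))‖ = Real.exp (-l.re * (s - T)) := by
    intro s
    rw [Complex.norm_exp]
    congr 1
    simp [Complex.mul_re]
  have hW : ∀ s : ℝ, 0 ≤ s →
      HasDerivWithinAt W (Complex.exp (-l * ((s - T : ℝ) : ℂ)) • g s) (Ici 0) s := by
    intro s hs
    have h1 : HasDerivAt (fun s : ℝ => -l * ((s - T : ℝ) : ℂ)) (-l) s := by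
      simpa using (((hasDerivAt_id s).sub_const T).ofReal_comp).const_mul (-l)
    have h2 := (h1.cexp.hasDerivWithinAt (s := Ici 0)).smul (hw s hs)
    refine h2.congr_deriv ?_
    rw [smul_add, smul_smul, add_right_comm, ← add_smul]
    simp
  have hB : ∀ s : ℝ, HasDerivAt
      (fun s => ‖w T‖ + M / (-l.re - μ) * Real.exp ((-l.re - μ) * (s - T)))
      (M * Real.exp ((-l.re - μ) * (s - T))) s := by
    intro s
    have h1 : HasDerivAt (fun s : ℝ => (-l.re - μ) * (s - T)) (-l.re - μ) s := by
      simpa using ((hasDerivAt_id s).sub_const T).const_mul (-l.re - μ)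
    have h2 := (h1.exp.const_mul (M / (-l.re - μ))).const_add ‖w T‖
    refine h2.congr_deriv ?_
    field_simp
  have key := image_norm_le_of_norm_deriv_right_le_deriv_boundary (f := W) (a := T) (b := t)
    (f' := fun s => Complex.exp (-l * ((s - T : ℝ) : ℂ)) • g s)
    (fun s hs => ((hW s (hT.trans hs.1)).continuousWithinAt).mono
      (fun r hr => hT.trans hr.1))
    (fun s hs => (hW s (hT.trans hs.1)).mono (fun r hr => (hT.trans hs.1).trans hr))
    (B := fun s => ‖w T‖ + M / (-l.re - μ) * Real.exp ((-l.re - μ) * (s - T)))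
    (by
      have : 0 ≤ M / (-l.re - μ) := by positivity
      simpa [W] using this)
    hB
    (fun s hs => by
      rw [norm_smul, hnexp]
      calc _ ≤ Real.exp (-l.re * (s - T)) * (M * Real.exp (-μ * (s - T))) := by
            gcongr
            exact hg s hs.1
        _ = _ := by
            rw [mul_left_comm, ← Real.exp_add]
            ring_nf)
    ⟨ht, le_rfl⟩
  simp only [W, norm_smul, hnexp] at key
  have hpos := Real.exp_pos (l.re * (t - T))
  calc ‖w t‖ = Real.exp (l.re * (t - T)) * (Real.exp (-l.re * (t - T)) * ‖w t‖) := by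
        rw [← mul_assoc, ← Real.exp_add]
        simp
    _ ≤ Real.exp (l.re * (t - T)) *
        (‖w T‖ + M / (-l.re - μ) * Real.exp ((-l.re - μ) * (t - T))) := by gcongr
    _ = _ := by
        rw [mul_add, mul_left_comm, ← Real.exp_add]
        ring_nf

theorem BoundedSignal.of_hasDerivWithinAt_smul_add {l : ℂ} (hl : l.re < 0) {w g : ℝ → V}
    (hw : ∀ t : ℝ, 0 ≤ t → HasDerivWithinAt w (l • w t + g t) (Ici 0) t)
    (hg : BoundedSignal g) : BoundedSignal w := by
  obtain ⟨M, hM⟩ := hg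
  refine ⟨‖w 0‖ + M / (-l.re), fun t ht => ?_⟩
  have h := norm_le_of_hasDerivWithinAt_smul_add (μ := 0) (M := M) le_rfl (by linarith) hw
    (fun t ht => by simpa using hM t ht) ht
  have h1 : Real.exp (l.re * (t - 0)) ≤ 1 :=
    Real.exp_le_one_iff.2 (mul_nonpos_of_nonpos_of_nonneg hl.le (by linarith))
  have h2 := mul_le_mul_of_nonneg_right h1 (norm_nonneg (w 0))
  simp only [neg_zero, zero_mul, Real.exp_zero, sub_zero] at h h2
  linarith

theorem ExpDecaying.of_hasDerivWithinAt_smul_add {l : ℂ} (hl : l.re < 0) {w g : ℝ → V}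
    (hw : ∀ t : ℝ, 0 ≤ t → HasDerivWithinAt w (l • w t + g t) (Ici 0) t)
    (hg : ExpDecaying g) : ExpDecaying w := by
  obtain ⟨M, μ, hμ, hM⟩ := hg
  have hM0 : 0 ≤ M := by simpa using (norm_nonneg _).trans (hM 0 le_rfl)
  -- A rate at most that of the input and strictly below that of the filter, which excludes
  -- resonance.
  set ν := min μ (-l.re / 2) with hν
  have hν0 : 0 < ν := lt_min hμ (by linarith)
  have hνl : ν < -l.re := (min_le_right _ _).trans_lt (by linarith)
  refine ⟨‖w 0‖ + M / (-l.re - ν), ν, hν0, fun t ht => ?_⟩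
  have h := norm_le_of_hasDerivWithinAt_smul_add (μ := ν) (M := M) le_rfl hνl hw
    (fun t ht => (hM t ht).trans (by
      have : ν ≤ μ := min_le_left _ _
      rw [sub_zero]
      gcongr)) ht
  rw [sub_zero] at h
  refine h.trans ?_
  have h1 : Real.exp (l.re * t) ≤ Real.exp (-ν * t) := by
    gcongr
    linarith
  have h2 := mul_le_mul_of_nonneg_right h1 (norm_nonneg (w 0))
  linarith

theorem tendsto_zero_of_hasDerivWithinAt_smul_add {l : ℂ} (hl : l.re < 0) {w g : ℝ → V}
    (hw : ∀ t : ℝ, 0 ≤ t → HasDerivWithinAt w (l • w t + g t) (Ici 0) t)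
    (hg : Tendsto g atTop (𝓝 0)) : Tendsto w atTop (𝓝 0) := by
  rw [NormedAddGroup.tendsto_nhds_zero] at hg ⊢
  intro ε hε
  -- With the input below this threshold from T on, the forced response is at most ε/2; the response
  -- to `w T` decays.
  obtain ⟨T₀, hT₀⟩ := eventually_atTop.1 (hg (-l.re * (ε / 2)) (by nlinarith))
  set T := max T₀ 0
  have h := fun t (ht : T ≤ t) => norm_le_of_hasDerivWithinAt_smul_add (μ := 0)
    (M := -l.re * (ε / 2)) (T := T) (le_max_right _ _) (by linarith) hw
    (fun t ht => by simpa using (hT₀ t ((le_max_left _ _).trans ht)).le) ht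
  have hlim : Tendsto (fun t : ℝ => Real.exp (l.re * (t - T)) * ‖w T‖) atTop (𝓝 0) := by
    rw [← zero_mul ‖w T‖]
    refine Tendsto.mul_const _ (Real.tendsto_exp_atBot.comp ?_)
    exact (tendsto_atTop_add_const_right _ (-T) tendsto_id).const_mul_atTop_of_neg hl
  filter_upwards [hlim.eventually (gt_mem_nhds (half_pos hε)), eventually_ge_atTop T]
    with t h1 h2
  have h3 := h t h2
  have h4 : -l.re * (ε / 2) / (-l.re - 0) = ε / 2 := by
    rw [sub_zero, mul_div_cancel_left₀]
    linarith
  rw [h4] at h3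
  simp only [neg_zero, zero_mul, Real.exp_zero] at h3
  linarith

end ScalarFilter

/-! ### Hurwitz matrix filters, reduced to scalar ones. -/

section MatrixFilter

open Polynomial in
/-- A class of signals that is stable under sums, constant matrices and scalar first order stable
filters contains the states of every stable filter driven by a signal of the class. -/
theorem filter_state_induction {n : ℕ} (S : (ℝ → Fin n → ℂ) → Prop)
    (hadd : ∀ f g, S f → S g → S (fun t => f t + g t))
    (hmap : ∀ (A : Matrix (Fin n) (Fin n) ℂ) f, S f → S (fun t => A *ᵥ f t))
    (hfil : ∀ (l : ℂ), l.re < 0 → ∀ w g : ℝ → Fin n → ℂ,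
      (∀ t : ℝ, 0 ≤ t → HasDerivWithinAt w (l • w t + g t) (Ici 0) t) → S g → S w)
    (F : Matrix (Fin n) (Fin n) ℂ) (r : Multiset ℂ) (hr : ∀ l ∈ r, l.re < 0) :
    ∀ z f : ℝ → Fin n → ℂ,
      (∀ t : ℝ, 0 ≤ t → HasDerivWithinAt z (F *ᵥ z t + f t) (Ici 0) t) → S f →
      S (fun t => aeval F (r.map fun l => X - C l).prod *ᵥ z t) → S z := by
  induction r using Multiset.induction_on with
  | empty =>
    intro z f _ _ h
    simpa using h
  | cons l r ih =>
    intro z f hz hf h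
    -- G commutes with F, so Gz is again a filter state with one factor fewer to annihilate; and z'
    -- = lz + (Gz + f) is a scalar filter.
    set G : Matrix (Fin n) (Fin n) ℂ := F - algebraMap ℂ _ l with hG
    have hw : S (fun t => G *ᵥ z t) := by
      refine ih (fun l hl => hr l (Multiset.mem_cons_of_mem hl)) _ (fun t => G *ᵥ f t) ?_
        (hmap G f hf) ?_
      · intro t ht
        have h1 := ((Matrix.mulVecLin G).toContinuousLinearMap.restrictScalars ℝ
          ).hasFDerivAt.comp_hasDerivWithinAt t (hz t ht)
        refine h1.congr_deriv ?_
        have hcomm : G * F = F * G := by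
          rw [hG, sub_mul, mul_sub, Algebra.commutes]
        simp [Matrix.mulVec_add, hcomm]
      · convert h using 2 with t
        rw [Matrix.mulVec_mulVec]
        congr 1
        rw [Multiset.map_cons, Multiset.prod_cons, mul_comm, map_mul]
        simp [hG]
    refine hfil l (hr l (Multiset.mem_cons_self _ _)) z (fun t => G *ᵥ z t + f t) ?_
      (hadd _ _ hw hf)
    intro t ht
    refine (hz t ht).congr_deriv ?_
    rw [← add_assoc, hG, Matrix.sub_mulVec]
    simp [Algebra.algebraMap_eq_smul_one, Matrix.smul_mulVec]

-- By Cayley–Hamilton, the product over all characteristic roots annihilates z, which supplies the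
-- base of the induction.
open Polynomial in
theorem filter_state_of_hurwitz {n : ℕ} (S : (ℝ → Fin n → ℂ) → Prop)
    (hzero : S (fun _ => 0))
    (hadd : ∀ f g, S f → S g → S (fun t => f t + g t))
    (hmap : ∀ (A : Matrix (Fin n) (Fin n) ℂ) f, S f → S (fun t => A *ᵥ f t))
    (hfil : ∀ (l : ℂ), l.re < 0 → ∀ w g : ℝ → Fin n → ℂ,
      (∀ t : ℝ, 0 ≤ t → HasDerivWithinAt w (l • w t + g t) (Ici 0) t) → S g → S w)
    {F : Matrix (Fin n) (Fin n) ℝ} (hF : IsHurwitz F) {z f : ℝ → Fin n → ℂ}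
    (hz : ∀ t : ℝ, 0 ≤ t →
      HasDerivWithinAt z (F.map (algebraMap ℝ ℂ) *ᵥ z t + f t) (Ici 0) t)
    (hf : S f) : S z := by
  refine filter_state_induction S hadd hmap hfil _ (F.map (algebraMap ℝ ℂ)).charpoly.roots ?_
    _ _ hz hf ?_
  · intro l hl
    exact hF l (Matrix.mem_spectrum_of_isRoot_charpoly (isRoot_of_mem_roots hl))
  · rw [← (IsAlgClosed.splits (charpoly _)).eq_prod_roots_of_monic (charpoly_monic _),
      Matrix.aeval_self_charpoly]
    simpa using hzero

/-- The complexification of a real filter equation. -/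
theorem hasDerivWithinAt_ofReal_filter {n : ℕ} {F : Matrix (Fin n) (Fin n) ℝ}
    {z f : ℝ → Fin n → ℝ}
    (hz : ∀ t : ℝ, 0 ≤ t → HasDerivWithinAt z (F *ᵥ z t + f t) (Ici 0) t) (t : ℝ) (ht : 0 ≤ t) :
    HasDerivWithinAt (fun t i => (z t i : ℂ))
      (F.map (algebraMap ℝ ℂ) *ᵥ (fun i => (z t i : ℂ)) + fun i => (f t i : ℂ)) (Ici 0) t := by
  rw [hasDerivWithinAt_pi]
  intro i
  have h1 := ((hasDerivWithinAt_pi.1 (hz t ht)) i).ofReal_comp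
  refine h1.congr_deriv ?_
  have h2 := RingHom.map_mulVec (algebraMap ℝ ℂ) F (z t) i
  simp only [Complex.coe_algebraMap, Pi.add_apply, Complex.ofReal_add] at h2 ⊢
  rw [h2]
  rfl

theorem norm_ofReal_pi {n : ℕ} (v : Fin n → ℝ) : ‖fun i => (v i : ℂ)‖ = ‖v‖ := by
  simp [Pi.norm_def, nnnorm]

theorem exists_norm_mulVec_le {n : ℕ} (A : Matrix (Fin n) (Fin n) ℂ) :
    ∃ K : ℝ, 0 ≤ K ∧ ∀ v, ‖A *ᵥ v‖ ≤ K * ‖v‖ :=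
  ⟨‖(Matrix.mulVecLin A).toContinuousLinearMap‖, norm_nonneg _, fun v =>
    (Matrix.mulVecLin A).toContinuousLinearMap.le_opNorm v⟩

variable {n : ℕ} {F : Matrix (Fin n) (Fin n) ℝ} {z f : ℝ → Fin n → ℝ}

theorem IsHurwitz.boundedSignal (hF : IsHurwitz F)
    (hz : ∀ t : ℝ, 0 ≤ t → HasDerivWithinAt z (F *ᵥ z t + f t) (Ici 0) t)
    (hf : BoundedSignal f) : BoundedSignal z := by
  have h := filter_state_of_hurwitz BoundedSignal ⟨0, by simp⟩
    (fun f g ⟨M, hM⟩ ⟨N, hN⟩ => ⟨M + N, fun t ht =>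
      (norm_add_le _ _).trans (add_le_add (hM t ht) (hN t ht))⟩)
    (fun A f ⟨M, hM⟩ => by
      obtain ⟨K, hK, h⟩ := exists_norm_mulVec_le A
      exact ⟨K * M, fun t ht => (h _).trans (by gcongr; exact hM t ht)⟩)
    (fun l hl w g hw hg => hg.of_hasDerivWithinAt_smul_add hl hw) hF (hasDerivWithinAt_ofReal_filter hz)
    (by simpa only [BoundedSignal, norm_ofReal_pi] using hf)
  simpa only [BoundedSignal, norm_ofReal_pi] using h

theorem IsHurwitz.expDecaying (hF : IsHurwitz F)
    (hz : ∀ t : ℝ, 0 ≤ t → HasDerivWithinAt z (F *ᵥ z t) (Ici 0) t) : ExpDecaying z := by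
  have h := filter_state_of_hurwitz ExpDecaying ⟨0, 1, by simp⟩
    (fun f g ⟨M, μ, hμ, hM⟩ ⟨N, ν, hν, hN⟩ => by
      have hM0 : 0 ≤ M := by simpa using (norm_nonneg _).trans (hM 0 le_rfl)
      have hN0 : 0 ≤ N := by simpa using (norm_nonneg _).trans (hN 0 le_rfl)
      refine ⟨M + N, min μ ν, lt_min hμ hν, fun t ht => ?_⟩
      rw [add_mul]
      refine (norm_add_le _ _).trans (add_le_add ((hM t ht).trans ?_) ((hN t ht).trans ?_))
      · gcongr
        exact min_le_left _ _
      · gcongr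
        exact min_le_right _ _)
    (fun A f ⟨M, μ, hμ, hM⟩ => by
      obtain ⟨K, hK, h⟩ := exists_norm_mulVec_le A
      refine ⟨K * M, μ, hμ, fun t ht => (h _).trans ?_⟩
      rw [mul_assoc]
      gcongr
      exact hM t ht)
    (fun l hl w g hw hg => hg.of_hasDerivWithinAt_smul_add hl hw) hF
    (hasDerivWithinAt_ofReal_filter (f := fun _ => 0) (by simpa using hz)) ⟨0, 1, one_pos, fun t _ => (norm_ofReal_pi (0 : Fin n → ℝ)).le.trans (by simp)⟩
  simpa only [ExpDecaying, norm_ofReal_pi] using h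

/-- Stated for complex signals because the inversion of H compares the real filter state with
complex differential polynomials. -/
theorem IsHurwitz.tendsto_zero_complex (hF : IsHurwitz F) {z f : ℝ → Fin n → ℂ}
    (hz : ∀ t : ℝ, 0 ≤ t →
      HasDerivWithinAt z (F.map (algebraMap ℝ ℂ) *ᵥ z t + f t) (Ici 0) t)
    (hf : Tendsto f atTop (𝓝 0)) : Tendsto z atTop (𝓝 0) :=
  filter_state_of_hurwitz (fun f => Tendsto f atTop (𝓝 0)) tendsto_const_nhds
    (fun f g hf hg => by simpa using hf.add hg)
    (fun A f hf => by
      have h := ((Matrix.mulVecLin A).toContinuousLinearMap.continuous.tendsto 0).comp hf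
      simpa [Function.comp_def] using h)
    (fun l hl w g hw hg => tendsto_zero_of_hasDerivWithinAt_smul_add hl hw hg) hF hz hf

theorem IsHurwitz.tendsto_zero (hF : IsHurwitz F)
    (hz : ∀ t : ℝ, 0 ≤ t → HasDerivWithinAt z (F *ᵥ z t + f t) (Ici 0) t)
    (hf : Tendsto f atTop (𝓝 0)) : Tendsto z atTop (𝓝 0) := by
  have h := hF.tendsto_zero_complex (hasDerivWithinAt_ofReal_filter hz)
    (by rw [tendsto_zero_iff_norm_tendsto_zero] at hf ⊢; simpa only [norm_ofReal_pi] using hf)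
  rw [tendsto_zero_iff_norm_tendsto_zero] at h ⊢
  simpa only [norm_ofReal_pi] using h

end MatrixFilter

/-! ### Global solutions of Lipschitz equations. -/

section GlobalExistence

variable {E : Type*} [NormedAddCommGroup E] [NormedSpace ℝ E]

theorem norm_integral_le_of_norm_le_exp {h : ℝ → E} {l C τ : ℝ} (hl : 0 < l) (hτ : 0 ≤ τ)
    (hb : ∀ s, 0 ≤ s → ‖h s‖ ≤ C * Real.exp (l * s)) :
    ‖∫ s in (0 : ℝ)..τ, h s‖ ≤ C / l * Real.exp (l * τ) := by
  have hC : 0 ≤ C := by simpa using (norm_nonneg _).trans (hb 0 le_rfl)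
  have hd : ∀ s : ℝ, HasDerivAt (fun s => C / l * Real.exp (l * s)) (C * Real.exp (l * s)) s := by
    intro s
    have h1 : HasDerivAt (fun s : ℝ => l * s) l s := by
      simpa using (hasDerivAt_id s).const_mul l
    refine (h1.exp.const_mul (C / l)).congr_deriv ?_
    field_simp
  have hc : Continuous fun s => C * Real.exp (l * s) := by fun_prop
  have hi := intervalIntegral.integral_eq_sub_of_hasDerivAt (a := 0) (b := τ)
    (fun s _ => hd s) (hc.intervalIntegrable _ _)
  have := intervalIntegral.norm_integral_le_of_norm_le (f := h) hτ
    (Eventually.of_forall fun s hs => hb s hs.1.le)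
    (hc.intervalIntegrable (μ := MeasureTheory.volume) 0 τ)
  rw [hi] at this
  have : 0 ≤ C / l * Real.exp (l * 0) := by positivity
  linarith

variable [CompleteSpace E]

open scoped NNReal BoundedContinuousFunction

/-- Global existence for a globally Lipschitz right-hand side, by contraction in an exponentially
weighted space of continuous functions. -/
theorem exists_solution_of_lipschitz {f : ℝ → E → E} (hf : Continuous (Function.uncurry f))
    {K : ℝ≥0} (hK : ∀ t, LipschitzWith K (f t)) {B : ℝ} (hB : ∀ t, ‖f t 0‖ ≤ B) (x₀ : E) :
    ∃ x : ℝ → E, x 0 = x₀ ∧ ∀ t, 0 ≤ t → HasDerivWithinAt x (f t (x t)) (Ici 0) t := by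
  -- The unknown is w(t) = exp(-lt) x(t). In this weight the Picard map has Lipschitz constant K/l ≤
  -- 1/2 on the whole half-line.
  set l : ℝ := 2 * K + 1 with hldef
  have hl : 0 < l := by positivity
  have hB0 : 0 ≤ B := (norm_nonneg _).trans (hB 0)
  set h : (ℝ →ᵇ E) → ℝ → E := fun w s => f s (Real.exp (l * s) • w s) with hh
  have hcont : ∀ w, Continuous (h w) := fun w => by
    have h1 : Continuous fun s : ℝ => (s, Real.exp (l * s) • w s) := by
      have := w.continuous
      fun_prop
    exact hf.comp h1
  have hdist : ∀ w w' s, ‖h w s - h w' s‖ ≤ K * ‖w - w'‖ * Real.exp (l * s) := by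
    intro w w' s
    have h1 := (hK s).norm_sub_le (Real.exp (l * s) • w s) (Real.exp (l * s) • w' s)
    rw [← smul_sub, norm_smul, Real.norm_of_nonneg (Real.exp_pos _).le] at h1
    have h2 : ‖w s - w' s‖ ≤ ‖w - w'‖ := (w - w').norm_coe_le_norm s
    calc _ ≤ _ := h1
      _ ≤ K * (Real.exp (l * s) * ‖w - w'‖) := by gcongr
      _ = _ := by ring
  have hbd : ∀ w s, 0 ≤ s → ‖h w s‖ ≤ (B + K * ‖w‖) * Real.exp (l * s) := by
    intro w s hs
    have h1 := hdist w 0 s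
    have h2 : h 0 s = f s 0 := by simp [hh]
    rw [h2, sub_zero] at h1
    have h3 := norm_le_insert' (h w s) (f s 0)
    have h4 : 1 ≤ Real.exp (l * s) := Real.one_le_exp (by positivity)
    nlinarith [hB s]
  set I : (ℝ →ᵇ E) → ℝ → E := fun w t => x₀ + ∫ s in (0 : ℝ)..t, h w s with hI
  have hId : ∀ w t, HasDerivAt (I w) (h w t) t := fun w t =>
    (intervalIntegral.integral_hasDerivAt_right ((hcont w).intervalIntegrable _ _)
      ((hcont w).stronglyMeasurableAtFilter _ _) (hcont w).continuousAt).const_add x₀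
  have hIc : ∀ w, Continuous (I w) := fun w =>
    continuous_iff_continuousAt.2 fun t => (hId w t).continuousAt
  have hexp : ∀ τ : ℝ, Real.exp (-l * τ) * Real.exp (l * τ) = 1 := fun τ => by
    rw [← Real.exp_add]
    simp
  -- Freezing the value at negative times keeps the image bounded on all of ℝ, so that it lies in
  -- the Banach space.
  have hΦc : ∀ w, Continuous fun t => Real.exp (-l * max t 0) • I w (max t 0) := fun w => by
    have := (hIc w).comp (continuous_id.max (continuous_const (y := (0 : ℝ))))
    simp only [Function.comp_def, id] at this
    fun_prop
  have hΦb : ∀ w t, ‖Real.exp (-l * max t 0) • I w (max t 0)‖ ≤ ‖x₀‖ + (B + K * ‖w‖) / l := by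
    intro w t
    have hτ := le_max_right t 0
    set τ := max t 0
    have h1 := norm_integral_le_of_norm_le_exp hl hτ (hbd w)
    have h2 : Real.exp (-l * τ) ≤ 1 := Real.exp_le_one_iff.2 (by nlinarith)
    rw [norm_smul, Real.norm_of_nonneg (Real.exp_pos _).le]
    calc _ ≤ Real.exp (-l * τ) * (‖x₀‖ + (B + K * ‖w‖) / l * Real.exp (l * τ)) := by
          gcongr
          exact (norm_add_le _ _).trans (by gcongr)
      _ = Real.exp (-l * τ) * ‖x₀‖ +
          (B + K * ‖w‖) / l * (Real.exp (-l * τ) * Real.exp (l * τ)) := by ring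
      _ ≤ 1 * ‖x₀‖ + (B + K * ‖w‖) / l * 1 := by
          rw [hexp]
          gcongr
      _ = _ := by ring
  set Φ : (ℝ →ᵇ E) → (ℝ →ᵇ E) := fun w =>
    BoundedContinuousFunction.ofNormedAddCommGroup _ (hΦc w) _ (hΦb w) with hΦ
  have hcontr : ContractingWith (1 / 2) Φ := by
    refine ⟨by norm_num, LipschitzWith.of_dist_le_mul fun w w' => ?_⟩
    rw [dist_eq_norm w w', BoundedContinuousFunction.dist_le (by positivity)]
    intro t
    have hτ := le_max_right t 0
    simp only [hΦ, BoundedContinuousFunction.coe_ofNormedAddCommGroup]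
    set τ := max t 0
    rw [dist_eq_norm, ← smul_sub, norm_smul, Real.norm_of_nonneg (Real.exp_pos _).le]
    have h1 : I w τ - I w' τ = ∫ s in (0 : ℝ)..τ, (h w s - h w' s) := by
      rw [intervalIntegral.integral_sub ((hcont w).intervalIntegrable _ _)
        ((hcont w').intervalIntegrable _ _)]
      simp [hI]
    rw [h1]
    have h2 := norm_integral_le_of_norm_le_exp (h := fun s => h w s - h w' s) hl hτ
      (fun s _ => hdist w w' s)
    calc _ ≤ Real.exp (-l * τ) * (K * ‖w - w'‖ / l * Real.exp (l * τ)) := by gcongr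
      _ = K / l * ‖w - w'‖ * (Real.exp (-l * τ) * Real.exp (l * τ)) := by ring
      _ = K / l * ‖w - w'‖ := by rw [hexp, mul_one]
      _ ≤ _ := by
          gcongr
          rw [div_le_iff₀ hl, hldef]
          push_cast
          linarith
  set w := ContractingWith.fixedPoint Φ hcontr
  have hw : ∀ t, 0 ≤ t → w t = Real.exp (-l * t) • I w t := by
    intro t ht
    have h1 : Φ w = w := hcontr.fixedPoint_isFixedPt
    have h2 := DFunLike.congr_fun h1 t
    rw [← h2]
    simp [hΦ, max_eq_left ht]
  have hx : ∀ t, 0 ≤ t → h w t = f t (I w t) := by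
    intro t ht
    simp only [hh]
    rw [hw t ht, smul_smul, mul_comm, hexp, one_smul]
  exact ⟨I w, by simp [hI], fun t ht => hx t ht ▸ (hId w t).hasDerivWithinAt⟩

theorem exists_solution_of_lipschitz_Ici {f : ℝ → E → E}
    (hf : ContinuousOn (Function.uncurry f) (Ici 0 ×ˢ univ))
    {K : ℝ≥0} (hK : ∀ t, 0 ≤ t → LipschitzWith K (f t)) {B : ℝ}
    (hB : ∀ t, 0 ≤ t → ‖f t 0‖ ≤ B) (x₀ : E) :
    ∃ x : ℝ → E, x 0 = x₀ ∧ ∀ t, 0 ≤ t → HasDerivWithinAt x (f t (x t)) (Ici 0) t := by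
  obtain ⟨x, hx0, hx⟩ := exists_solution_of_lipschitz (f := fun t => f (max t 0))
    (by
      have h1 : Continuous fun p : ℝ × E => (max p.1 0, p.2) := by fun_prop
      exact hf.comp_continuous h1 fun p => ⟨le_max_right p.1 0, mem_univ _⟩)
    (fun t => hK _ (le_max_right _ _)) (fun t => hB _ (le_max_right _ _)) x₀
  refine ⟨x, hx0, fun t ht => ?_⟩
  simpa [max_eq_left ht] using hx t ht

/-- Global solutions of `x' = A x + g` for a constant operator and a bounded continuous input. -/
theorem exists_solution_linear (A : E →L[ℝ] E) {g : ℝ → E} (hg : ContinuousOn g (Ici 0))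
    (hgb : BoundedSignal g) (x₀ : E) :
    ∃ x : ℝ → E, x 0 = x₀ ∧ ∀ t, 0 ≤ t → HasDerivWithinAt x (A (x t) + g t) (Ici 0) t := by
  obtain ⟨B, hB⟩ := hgb
  refine exists_solution_of_lipschitz_Ici (f := fun t x => A x + g t) (K := ‖A‖₊) (B := B) ?_ ?_
    (by simpa using hB) x₀
  · have h1 : ContinuousOn (fun p : ℝ × E => g p.1) (Ici 0 ×ˢ univ) :=
      hg.comp continuousOn_fst fun p hp => hp.1
    exact (A.continuous.comp continuous_snd).continuousOn.add h1
  · intro t _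
    simpa using A.lipschitz.add (LipschitzWith.const (g t))

end GlobalExistence

/-! ### Barbalat's lemma and the calculus of bounded uniformly continuous signals. -/

section Barbalat

variable {E E' : Type*} [NormedAddCommGroup E] [NormedAddCommGroup E']

/-- Barbalat's lemma. -/
theorem tendsto_deriv_zero_of_tendsto [NormedSpace ℝ E] {G g : ℝ → E} {l : E}
    (hG : ∀ t, 0 ≤ t → HasDerivWithinAt G (g t) (Ici 0) t)
    (hg : UniformContinuousOn g (Ici 0)) (hl : Tendsto G atTop (𝓝 l)) :
    Tendsto g atTop (𝓝 0) := by
  rw [NormedAddGroup.tendsto_nhds_zero]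
  intro ε hε
  obtain ⟨δ, hδ, h⟩ := Metric.uniformContinuousOn_iff.1 hg (ε / 2) (half_pos hε)
  set r := δ / 2 with hr
  have hr0 : 0 < r := half_pos hδ
  have hdiff : Tendsto (fun t => G (t + r) - G t) atTop (𝓝 0) := by
    simpa using (hl.comp (tendsto_atTop_add_const_right _ r tendsto_id)).sub hl
  rw [NormedAddGroup.tendsto_nhds_zero] at hdiff
  filter_upwards [hdiff (r * (ε / 2)) (by positivity), eventually_ge_atTop 0] with t h1 ht
  -- On a window of length r the derivative stays within ε/2 of `g t`, so `r • g t` differs from the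
  -- increment of G, which tends to 0, by at most rε/2.
  have h2 := Convex.norm_image_sub_le_of_norm_hasDerivWithin_le
    (f := fun s => G s - (s - t) • g t) (f' := fun s => g s - (1 : ℝ) • g t) (C := ε / 2)
    (s := Icc t (t + r)) (x := t) (y := t + r)
    (fun s hs => ((hG s (ht.trans hs.1)).mono fun u hu => ht.trans hu.1).sub
      (((hasDerivWithinAt_id s _).sub_const t).smul_const (g t)))
    (fun s hs => by
      have := h s (ht.trans hs.1) t ht (by
        rw [Real.dist_eq, abs_of_nonneg (by linarith [hs.1])]
        linarith [hs.2])
      rw [dist_eq_norm] at this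
      simpa using this.le)
    (convex_Icc _ _) ⟨le_rfl, by linarith⟩ ⟨by linarith, le_rfl⟩
  have h3 : r • g t = (G (t + r) - G t) -
      ((G (t + r) - (t + r - t) • g t) - (G t - (t - t) • g t)) := by
    simp
  have h4 : r * ‖g t‖ ≤ ‖G (t + r) - G t‖ + ε / 2 * r := by
    rw [← Real.norm_of_nonneg hr0.le, ← norm_smul, h3]
    refine (norm_sub_le _ _).trans ?_
    rw [Real.norm_of_nonneg hr0.le]
    gcongr
    simpa [abs_of_pos hr0] using h2
  have : r * ‖g t‖ < r * ε := by linarith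
  exact lt_of_mul_lt_mul_left this hr0.le

theorem BoundedSignal.prodMk {f : ℝ → E} {g : ℝ → E'} (hf : BoundedSignal f)
    (hg : BoundedSignal g) : BoundedSignal fun t => (f t, g t) := by
  obtain ⟨M, hM⟩ := hf
  obtain ⟨N, hN⟩ := hg
  refine ⟨max M N, fun t ht => ?_⟩
  rw [Prod.norm_mk]
  exact max_le_max (hM t ht) (hN t ht)

theorem BoundedSignal.pi {ι : Type*} [Fintype ι] {f : ι → ℝ → E}
    (hf : ∀ i, BoundedSignal (f i)) : BoundedSignal fun t i => f i t := by
  choose M hM using hf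
  refine ⟨‖M‖, fun t ht => (pi_norm_le_iff_of_nonneg (norm_nonneg _)).2 fun i => ?_⟩
  exact (hM i t ht).trans ((le_abs_self _).trans (norm_le_pi_norm M i))

theorem BoundedSignal.comp [ProperSpace E] {f : ℝ → E} {Φ : E → E'} (hf : BoundedSignal f)
    (hΦ : Continuous Φ) : BoundedSignal fun t => Φ (f t) := by
  obtain ⟨M, hM⟩ := hf
  obtain ⟨C, hC⟩ := (isCompact_closedBall (0 : E) M).exists_bound_of_continuousOn
    hΦ.continuousOn
  exact ⟨C, fun t ht => hC _ (by simpa using hM t ht)⟩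

/-- Bounded and uniformly continuous on `[0, ∞)`. -/
structure BddUniformContinuous (f : ℝ → E) : Prop where
  bounded : BoundedSignal f
  uniform : UniformContinuousOn f (Ici 0)

namespace BddUniformContinuous

theorem of_hasDerivWithinAt [NormedSpace ℝ E] {f f' : ℝ → E} (hf : BoundedSignal f)
    (hd : ∀ t, 0 ≤ t → HasDerivWithinAt f (f' t) (Ici 0) t) (hf' : BoundedSignal f') :
    BddUniformContinuous f := by
  obtain ⟨C, hC⟩ := hf'
  refine ⟨hf, LipschitzOnWith.uniformContinuousOn (K := C.toNNReal)
    ((convex_Ici 0).lipschitzOnWith_of_nnnorm_hasDerivWithin_le (f' := f') hd fun t ht => ?_)⟩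
  rw [← NNReal.coe_le_coe, coe_nnnorm]
  exact (hC t ht).trans (Real.le_coe_toNNReal _)

theorem prodMk {f : ℝ → E} {g : ℝ → E'} (hf : BddUniformContinuous f)
    (hg : BddUniformContinuous g) : BddUniformContinuous fun t => (f t, g t) := by
  refine ⟨hf.bounded.prodMk hg.bounded, ?_⟩
  have hf := hf.uniform
  have hg := hg.uniform
  rw [uniformContinuousOn_iff_restrict] at hf hg ⊢
  exact hf.prodMk hg

theorem pi {ι : Type*} [Fintype ι] {f : ι → ℝ → E}
    (hf : ∀ i, BddUniformContinuous (f i)) : BddUniformContinuous fun t i => f i t := by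
  refine ⟨.pi fun i => (hf i).bounded, ?_⟩
  rw [uniformContinuousOn_iff_restrict, uniformContinuous_pi]
  intro i
  exact uniformContinuousOn_iff_restrict.1 (hf i).uniform

theorem comp [ProperSpace E] {f : ℝ → E} {Φ : E → E'} (hf : BddUniformContinuous f)
    (hΦ : Continuous Φ) : BddUniformContinuous fun t => Φ (f t) := by
  refine ⟨hf.bounded.comp hΦ, ?_⟩
  obtain ⟨M, hM⟩ := hf.bounded
  exact ((isCompact_closedBall (0 : E) M).uniformContinuousOn_of_continuous
    hΦ.continuousOn).comp hf.uniform fun t ht => by simpa using hM t ht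

end BddUniformContinuous

end Barbalat

/-! ### Polynomials in d/dt acting on a signal. -/

section DifferentialPolynomial

open Polynomial

/-- The signal `q(d/dt) ξ = ∑ q_i ξ⁽ⁱ⁾` for a signal `ξ` with derivatives `ξ⁽ⁱ⁾ = g i`, `i ≤ n`. -/
noncomputable def diffEval (n : ℕ) (g : ℕ → ℝ → ℂ) : ℂ[X] →ₗ[ℂ] (ℝ → ℂ) :=
  ∑ i ∈ Finset.range (n + 1), (lcoeff ℂ i).smulRight (g i)

theorem diffEval_apply (n : ℕ) (g : ℕ → ℝ → ℂ) (q : ℂ[X]) (t : ℝ) :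
    diffEval n g q t = ∑ i ∈ Finset.range (n + 1), q.coeff i * g i t := by
  simp [diffEval, LinearMap.sum_apply, Finset.sum_apply]

theorem hasDerivWithinAt_diffEval {n : ℕ} {g : ℕ → ℝ → ℂ}
    (hg : ∀ i < n, ∀ t, 0 ≤ t → HasDerivWithinAt (g i) (g (i + 1) t) (Ici 0) t)
    {q : ℂ[X]} (hq : q.natDegree < n) (t : ℝ) (ht : 0 ≤ t) :
    HasDerivWithinAt (diffEval n g q) (diffEval n g (X * q) t) (Ici 0) t := by
  have h1 : HasDerivWithinAt (fun s => ∑ i ∈ Finset.range n, q.coeff i * g i s)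
      (∑ i ∈ Finset.range n, q.coeff i * g (i + 1) t) (Ici 0) t :=
    HasDerivWithinAt.fun_sum fun i hi => (hg i (Finset.mem_range.1 hi) t ht).const_mul _
  have h2 : diffEval n g q = fun s => ∑ i ∈ Finset.range n, q.coeff i * g i s := by
    ext s
    rw [diffEval_apply, Finset.sum_range_succ, coeff_eq_zero_of_natDegree_lt hq]
    simp
  rw [h2, diffEval_apply, Finset.sum_range_succ']
  simpa using h1

/-- From Xq = lq + q(X - l): dividing a differential polynomial by X - l amounts to passing the
signal through a first order filter with pole l. -/
theorem hasDerivWithinAt_diffEval_factor {n : ℕ} {g : ℕ → ℝ → ℂ}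
    (hg : ∀ i < n, ∀ t, 0 ≤ t → HasDerivWithinAt (g i) (g (i + 1) t) (Ici 0) t)
    {q : ℂ[X]} (hq : q.natDegree < n) (l : ℂ) (t : ℝ) (ht : 0 ≤ t) :
    HasDerivWithinAt (diffEval n g q)
      (l • diffEval n g q t + diffEval n g (q * (X - C l)) t) (Ici 0) t := by
  refine (hasDerivWithinAt_diffEval hg hq t ht).congr_deriv ?_
  have : X * q = l • q + q * (X - C l) := by
    rw [smul_eq_C_mul]
    ring
  rw [this, map_add, map_smul]
  rfl

theorem natDegree_lt_of_mul_factor {n : ℕ} {q p : ℂ[X]} {l : ℂ} (hq : q.Monic) (hp : p.Monic)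
    (h : (q * ((X - C l) * p)).natDegree ≤ n) : q.natDegree < n := by
  rw [hq.natDegree_mul ((monic_X_sub_C l).mul hp), (monic_X_sub_C l).natDegree_mul hp,
    natDegree_X_sub_C] at h
  omega

/-- If `(q ∏ (X - l)) ξ` belongs to a class of signals closed under stable first order filters,
so does `q ξ`. -/
theorem diffEval_of_mul_prod {n : ℕ} {g : ℕ → ℝ → ℂ}
    (hg : ∀ i < n, ∀ t, 0 ≤ t → HasDerivWithinAt (g i) (g (i + 1) t) (Ici 0) t)
    (S : (ℝ → ℂ) → Prop)
    (hfil : ∀ (l : ℂ), l.re < 0 → ∀ w v : ℝ → ℂ,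
      (∀ t : ℝ, 0 ≤ t → HasDerivWithinAt w (l • w t + v t) (Ici 0) t) → S v → S w)
    (r : Multiset ℂ) (hr : ∀ l ∈ r, l.re < 0) :
    ∀ q : ℂ[X], q.Monic → (q * (r.map fun l => X - C l).prod).natDegree ≤ n →
      S (diffEval n g (q * (r.map fun l => X - C l).prod)) → S (diffEval n g q) := by
  induction r using Multiset.induction_on with
  | empty =>
    intro q _ _ h
    simpa using h
  | cons l r ih =>
    intro q hq hn h
    rw [Multiset.map_cons, Multiset.prod_cons] at hn h
    have hlt := natDegree_lt_of_mul_factor hq (monic_multiset_prod_of_monic _ _ fun l _ =>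
      monic_X_sub_C l) hn
    rw [← mul_assoc] at hn h
    exact hfil l (hr l (Multiset.mem_cons_self _ _)) _ _
      (hasDerivWithinAt_diffEval_factor hg hlt l)
      (ih (fun l hl => hr l (Multiset.mem_cons_of_mem hl)) _ (hq.mul (monic_X_sub_C l)) hn h)

theorem BddUniformContinuous.of_hasDerivWithinAt_smul_add {l : ℂ} (hl : l.re < 0) {w g : ℝ → ℂ}
    (hw : ∀ t : ℝ, 0 ≤ t → HasDerivWithinAt w (l • w t + g t) (Ici 0) t)
    (hg : BddUniformContinuous g) : BddUniformContinuous w := by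
  have hb := hg.bounded.of_hasDerivWithinAt_smul_add hl hw
  refine .of_hasDerivWithinAt hb hw ?_
  obtain ⟨M, hM⟩ := hb
  obtain ⟨N, hN⟩ := hg.bounded
  refine ⟨‖l‖ * M + N, fun t ht => (norm_add_le _ _).trans (add_le_add ?_ (hN t ht))⟩
  rw [norm_smul]
  gcongr
  exact hM t ht

/-- If `q ξ` vanishes at infinity and `(q ∏ (X - l)) ξ` is bounded and uniformly continuous, the
latter vanishes at infinity too. -/
theorem tendsto_diffEval_mul_prod {n : ℕ} {g : ℕ → ℝ → ℂ}
    (hg : ∀ i < n, ∀ t, 0 ≤ t → HasDerivWithinAt (g i) (g (i + 1) t) (Ici 0) t)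
    (r : Multiset ℂ) (hr : ∀ l ∈ r, l.re < 0) :
    ∀ q : ℂ[X], q.Monic → (q * (r.map fun l => X - C l).prod).natDegree ≤ n →
      BddUniformContinuous (diffEval n g (q * (r.map fun l => X - C l).prod)) →
      Tendsto (diffEval n g q) atTop (𝓝 0) →
      Tendsto (diffEval n g (q * (r.map fun l => X - C l).prod)) atTop (𝓝 0) := by
  induction r using Multiset.induction_on with
  | empty =>
    intro q _ _ _ h
    simpa using h
  | cons l r ih =>
    intro q hq hn hu h
    -- Every partial product is obtained from the full one by stable filters, hence inherits
    -- boundedness and uniform continuity.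
    have hfull := diffEval_of_mul_prod hg BddUniformContinuous
      (fun l hl w v hw hv => hv.of_hasDerivWithinAt_smul_add hl hw) _ hr q hq hn hu
    rw [Multiset.map_cons, Multiset.prod_cons] at hn hu ⊢
    have hlt := natDegree_lt_of_mul_factor hq (monic_multiset_prod_of_monic _ _ fun l _ =>
      monic_X_sub_C l) hn
    rw [← mul_assoc] at hn hu ⊢
    have hr' : ∀ l ∈ r, l.re < 0 := fun l hl => hr l (Multiset.mem_cons_of_mem hl)
    have hnext := diffEval_of_mul_prod hg BddUniformContinuous
      (fun l hl w v hw hv => hv.of_hasDerivWithinAt_smul_add hl hw) r hr' _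
      (hq.mul (monic_X_sub_C l)) hn hu
    refine ih hr' _ (hq.mul (monic_X_sub_C l)) hn hu ?_
    -- Barbalat gives (qξ)' → 0, and q(X - l)ξ = (qξ)' - l qξ.
    have hd := tendsto_deriv_zero_of_tendsto (hasDerivWithinAt_diffEval_factor hg hlt l)
      ((hfull.prodMk hnext).comp (Φ := fun p : ℂ × ℂ => l • p.1 + p.2) (by fun_prop)).uniform h
    simpa using hd.sub (h.const_smul l)

/-- The equation `D(d/dt) ξ = u` with monic `D` has a solution on `[0, ∞)`. -/
theorem exists_diffEval_eq (D : ℂ[X]) (hD : D.Monic) {u : ℝ → ℂ} (hu : BoundedSignal u)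
    (huc : ContinuousOn u (Ici 0)) :
    ∃ g : ℕ → ℝ → ℂ,
      (∀ i < D.natDegree, ∀ t, 0 ≤ t → HasDerivWithinAt (g i) (g (i + 1) t) (Ici 0) t) ∧
      diffEval D.natDegree g D = u := by
  set n := D.natDegree with hn
  -- Companion form: the components are ξ and its derivatives below order n, and the n-th derivative
  -- is eliminated through D, with u entering only the last equation.
  let ext : ℕ → (Fin n → ℂ) →ₗ[ℝ] ℂ := fun j =>
    if h : j < n then LinearMap.proj ⟨j, h⟩
    else -∑ i : Fin n, (LinearMap.mulLeft ℝ (D.coeff i)).comp (LinearMap.proj i)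
  let A : (Fin n → ℂ) →L[ℝ] (Fin n → ℂ) :=
    LinearMap.toContinuousLinearMap (LinearMap.pi fun i : Fin n => ext (i + 1))
  let f : ℝ → Fin n → ℂ := fun t i => if (i : ℕ) + 1 < n then 0 else u t
  have hfc : ContinuousOn f (Ici 0) := by
    refine continuousOn_pi.2 fun i => ?_
    by_cases h : (i : ℕ) + 1 < n
    · simpa [f, h] using continuousOn_const
    · simpa [f, h] using huc
  have hfb : BoundedSignal f := by
    obtain ⟨M, hM⟩ := hu
    refine ⟨M, fun t ht => ?_⟩
    have hM0 := (norm_nonneg _).trans (hM t ht)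
    refine (pi_norm_le_iff_of_nonneg hM0).2 fun i => ?_
    by_cases h : (i : ℕ) + 1 < n
    · simpa [f, h] using hM0
    · simpa [f, h] using hM t ht
  obtain ⟨η, -, hη⟩ := exists_solution_linear A hfc hfb 0
  refine ⟨fun j t => if h : j < n then η t ⟨j, h⟩ else u t - ∑ i : Fin n, D.coeff i * η t i,
    fun i hi t ht => ?_, ?_⟩
  · have h1 := hasDerivWithinAt_pi.1 (hη t ht) ⟨i, hi⟩
    simp only [dif_pos hi]
    refine h1.congr_deriv ?_
    by_cases h : i + 1 < n
    · simp [A, ext, f, h]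
    · simp [A, ext, f, h, LinearMap.sum_apply]
      ring
  · ext t
    rw [diffEval_apply, Finset.sum_range_succ, Finset.sum_range]
    have hD1 : D.coeff n = 1 := hD.coeff_natDegree
    simp [hD1]

end DifferentialPolynomial

/-! ### Asymptotic inversion of a minimum phase filter. -/

section MinimumPhase

open Polynomial

/-- A polynomial vector solving `(X - F) v = χ_F b`, of degree below the order of `F`. -/
theorem exists_charmatrix_solution {n : ℕ} (F : Matrix (Fin n) (Fin n) ℂ) (b : Fin n → ℂ) :
    ∃ v : Fin n → ℂ[X], (∀ i, (v i).natDegree < n) ∧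
      ∀ i, X * v i = ∑ j, C (F i j) * v j + F.charpoly * C (b i) := by
  set v : Fin n → ℂ[X] := F.charmatrix.adjugate *ᵥ fun i => C (b i) with hv
  have hmul : F.charmatrix *ᵥ v = F.charpoly • fun i => C (b i) := by
    rw [hv, Matrix.mulVec_mulVec, Matrix.mul_adjugate, Matrix.smul_mulVec, Matrix.one_mulVec]
    rfl
  have heq : ∀ i, X * v i = ∑ j, C (F i j) * v j + F.charpoly * C (b i) := by
    intro i
    have h := congrFun hmul i
    rw [Matrix.charmatrix, Matrix.sub_mulVec] at h
    simp only [Pi.sub_apply, Pi.smul_apply, smul_eq_mul] at h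
    rw [← h]
    simp [Matrix.mulVec, dotProduct, Matrix.diagonal_apply]
  refine ⟨v, fun i => ?_, heq⟩
  have : Nonempty (Fin n) := ⟨i⟩
  -- In a row of maximal degree, multiplication by X raises the degree by one. The right-hand side
  -- can match this only through the characteristic polynomial, of degree n, so the maximum is below
  -- n.
  obtain ⟨k, hk⟩ := Finite.exists_max fun i => (v i).natDegree
  refine (hk i).trans_lt ?_
  by_contra! hcon
  have hne : v k ≠ 0 := by
    intro h0
    have := i.pos
    simp [h0] at hcon
    omega
  have h1 : (X * v k).natDegree = (v k).natDegree + 1 := natDegree_X_mul hne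
  have h2 : (X * v k).natDegree ≤ (v k).natDegree := by
    rw [heq k]
    refine natDegree_add_le_of_degree_le (natDegree_sum_le_of_forall_le _ _ fun j _ => ?_) ?_
    · exact (natDegree_C_mul_le _ _).trans (hk j)
    · refine (natDegree_mul_C_le _ _).trans ?_
      rw [Matrix.charpoly_natDegree_eq_dim, Fintype.card_fin]
      exact hcon
  omega

variable {n : ℕ} {F : Matrix (Fin n) (Fin n) ℝ} {b c : Fin n → ℝ}

/-- Evaluating (X - F)v = χ_F b at s and inverting s - F identifies cᵀv as the numerator of H over
χ_F. -/
theorem eval_numerator_eq {v : Fin n → ℂ[X]}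
    (hv : ∀ i, X * v i = ∑ j, C (F.map (algebraMap ℝ ℂ) i j) * v j +
      (F.map (algebraMap ℝ ℂ)).charpoly * C (b i : ℂ)) {s : ℂ}
    (hs : s ∉ spectrum ℂ (F.map (algebraMap ℝ ℂ))) :
    ∑ i, (c i : ℂ) * (v i).eval s =
      (F.map (algebraMap ℝ ℂ)).charpoly.eval s * transferFunction F b c s := by
  set Fc := F.map (algebraMap ℝ ℂ) with hFc
  have hu : IsUnit (s • (1 : Matrix (Fin n) (Fin n) ℂ) - Fc) := by
    have := spectrum.notMem_iff.1 hs
    rwa [Algebra.algebraMap_eq_smul_one] at this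
  have h1 : (s • (1 : Matrix (Fin n) (Fin n) ℂ) - Fc) *ᵥ (fun i => (v i).eval s) =
      Fc.charpoly.eval s • fun i => (b i : ℂ) := by
    ext i
    have h := congrArg (Polynomial.eval s) (hv i)
    simp only [eval_mul, eval_X, eval_add, eval_finsetSum, eval_C] at h
    simp [Matrix.sub_mulVec, Matrix.smul_mulVec, h]
    simp [Matrix.mulVec, dotProduct]
  have h2 : (fun i => (v i).eval s) = Fc.charpoly.eval s •
      ((s • (1 : Matrix (Fin n) (Fin n) ℂ) - Fc)⁻¹ *ᵥ fun i => (b i : ℂ)) := by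
    rw [← Matrix.mulVec_smul, ← h1, Matrix.mulVec_mulVec,
      Matrix.nonsing_inv_mul _ ((Matrix.isUnit_iff_isUnit_det _).1 hu), Matrix.one_mulVec]
  change (fun i => (c i : ℂ)) ⬝ᵥ (fun i => (v i).eval s) = _
  rw [h2, dotProduct_smul, smul_eq_mul]
  rfl

/-- A bounded uniformly continuous input of a stable minimum phase filter vanishes at infinity as
soon as the output does. -/
theorem tendsto_input_of_tendsto_output (hF : IsHurwitz F) (hH : IsMinimumPhase F b c)
    {u : ℝ → ℝ} (hu : BddUniformContinuous u) {z : ℝ → Fin n → ℝ} (hz : IsFilterState F b u z)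
    (hout : Tendsto (fun t => c ⬝ᵥ z t) atTop (𝓝 0)) : Tendsto u atTop (𝓝 0) := by
  set Fc := F.map (algebraMap ℝ ℂ) with hFc
  obtain ⟨v, hdeg, hv⟩ := exists_charmatrix_solution Fc fun i => (b i : ℂ)
  have huc : BddUniformContinuous fun t => (u t : ℂ) := hu.comp Complex.continuous_ofReal
  -- Introduces ξ with χ_F(d/dt)ξ = u, so that u and, up to a decaying term, the output are
  -- differential polynomials in the same ξ.
  obtain ⟨g, hg, hgu⟩ := exists_diffEval_eq Fc.charpoly (charpoly_monic _) huc.bounded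
    huc.uniform.continuousOn
  rw [Matrix.charpoly_natDegree_eq_dim, Fintype.card_fin] at hg hgu
  -- The vector v(d/dt)ξ obeys the same filter equation as z, so the difference is an unforced
  -- Hurwitz state.
  have hstate : Tendsto (fun t i => diffEval n g (v i) t - (z t i : ℂ)) atTop (𝓝 0) := by
    refine hF.tendsto_zero_complex (f := fun _ => 0) (fun t ht => ?_) tendsto_const_nhds
    rw [hasDerivWithinAt_pi]
    intro i
    have h1 := hasDerivWithinAt_pi.1 (hasDerivWithinAt_ofReal_filter hz t ht) i
    refine ((hasDerivWithinAt_diffEval hg (hdeg i) t ht).sub h1).congr_deriv ?_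
    have h2 : diffEval n g (X * v i) t =
        ∑ j, Fc i j * diffEval n g (v j) t + u t * b i := by
      rw [hv i, map_add, map_sum, mul_comm Fc.charpoly, ← smul_eq_C_mul, map_smul, hgu]
      simp only [← smul_eq_C_mul, map_smul]
      simp [Finset.sum_apply, mul_comm]
    rw [h2]
    simp [hFc, Matrix.mulVec, dotProduct, mul_sub, Finset.sum_sub_distrib]
  set N : ℂ[X] := ∑ i, (c i : ℂ) • v i with hN
  have hNout : Tendsto (diffEval n g N) atTop (𝓝 0) := by
    have h1 : Tendsto (fun t => ∑ i, (c i : ℂ) * (diffEval n g (v i) t - (z t i : ℂ))) atTop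
        (𝓝 (∑ i, (c i : ℂ) * 0)) :=
      tendsto_finsetSum _ fun i _ => (tendsto_pi_nhds.1 hstate i).const_mul _
    have h2 : Tendsto (fun t => ((c ⬝ᵥ z t : ℝ) : ℂ)) atTop (𝓝 ((0 : ℝ) : ℂ)) :=
      (Complex.continuous_ofReal.tendsto _).comp hout
    convert h1.add h2 using 1
    · ext t
      simp [hN, dotProduct, mul_sub, Finset.sum_sub_distrib, Finset.sum_apply]
    · simp
  have hspec : ∀ s : ℂ, 0 ≤ s.re → s ∉ spectrum ℂ Fc := fun s hs h =>
    absurd (hF s h) (not_lt.2 hs)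
  have hroot : ∀ s : ℂ, N.eval s = 0 → s.re < 0 := by
    intro s h0
    by_contra! hs
    have h1 := eval_numerator_eq (c := c) hv (hspec s hs)
    have h2 : N.eval s = ∑ i, (c i : ℂ) * (v i).eval s := by simp [hN, eval_finsetSum]
    rw [← h2, h0, eq_comm, mul_eq_zero] at h1
    rcases h1 with h1 | h1
    · exact hspec s hs (Matrix.mem_spectrum_of_isRoot_charpoly h1)
    · exact absurd (hH s h1) (not_lt.2 hs)
  -- A zero numerator would have the root 1, in the right half-plane.
  have hN0 : N ≠ 0 := by
    intro h0
    have := hroot 1 (by simp [h0])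
    norm_num at this
  have hNsplit := (IsAlgClosed.splits N).eq_prod_roots
  have hNdeg : N.natDegree ≤ n := by
    refine natDegree_sum_le_of_forall_le _ _ fun i _ => ?_
    exact (natDegree_smul_le _ _).trans (hdeg i).le
  have hlead : N.leadingCoeff ≠ 0 := leadingCoeff_ne_zero.2 hN0
  have hprod : (N.roots.map fun l => X - C l).prod = N.leadingCoeff⁻¹ • N := by
    rw [eq_inv_smul_iff₀ hlead, smul_eq_C_mul, ← hNsplit]
  -- The roots of N are stable, so ξ is recovered from Nξ → 0 by stable filters; ascending through
  -- the factors of χ_F then reaches u.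
  have hξ : Tendsto (diffEval n g 1) atTop (𝓝 0) := by
    refine diffEval_of_mul_prod hg (fun f => Tendsto f atTop (𝓝 0))
      (fun l hl w v hw hv => tendsto_zero_of_hasDerivWithinAt_smul_add hl hw hv) N.roots
      (fun l hl => hroot l (isRoot_of_mem_roots hl)) 1 monic_one ?_ ?_
    · rw [one_mul, hprod]
      exact (natDegree_smul_le _ _).trans hNdeg
    · rw [one_mul, hprod, map_smul]
      have := hNout.const_smul N.leadingCoeff⁻¹
      rwa [smul_zero] at this
  have hD : (Fc.charpoly.roots.map fun l => X - C l).prod = Fc.charpoly :=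
    ((IsAlgClosed.splits Fc.charpoly).eq_prod_roots_of_monic (charpoly_monic _)).symm
  have hfinal := tendsto_diffEval_mul_prod hg Fc.charpoly.roots
    (fun l hl => hF l (Matrix.mem_spectrum_of_isRoot_charpoly (isRoot_of_mem_roots hl)))
    1 monic_one
    (by rw [one_mul, hD, Matrix.charpoly_natDegree_eq_dim, Fintype.card_fin])
    (by rw [one_mul, hD, hgu]; exact huc) hξ
  rw [one_mul, hD, hgu, tendsto_zero_iff_norm_tendsto_zero] at hfinal
  rw [tendsto_zero_iff_norm_tendsto_zero]
  simpa using hfinal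

end MinimumPhase

/-! ### The perturbed gradient law and persistent excitation. -/

section Gradient

theorem HasDerivWithinAt.dotProduct {ι : Type*} [Fintype ι] {f g : ℝ → ι → ℝ} {f' g' : ι → ℝ}
    {s : Set ℝ} {t : ℝ} (hf : HasDerivWithinAt f f' s t) (hg : HasDerivWithinAt g g' s t) :
    HasDerivWithinAt (fun t => f t ⬝ᵥ g t) (f' ⬝ᵥ g t + f t ⬝ᵥ g') s t := by
  rw [hasDerivWithinAt_pi] at hf hg
  have h := HasDerivWithinAt.fun_sum (u := Finset.univ) fun i _ => (hf i).mul (hg i)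
  refine h.congr_deriv ?_
  simp [_root_.dotProduct, Finset.sum_add_distrib]

theorem dotProduct_self_nonneg_real {ι : Type*} [Fintype ι] (v : ι → ℝ) : 0 ≤ v ⬝ᵥ v :=
  Finset.sum_nonneg fun i _ => mul_self_nonneg (v i)

theorem abs_dotProduct_le {m : ℕ} (v w : Fin m → ℝ) : |v ⬝ᵥ w| ≤ m * (‖v‖ * ‖w‖) := by
  calc |v ⬝ᵥ w| ≤ ∑ i, |v i * w i| := Finset.abs_sum_le_sum_abs _ _
    _ ≤ ∑ _i : Fin m, ‖v‖ * ‖w‖ := by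
        refine Finset.sum_le_sum fun i _ => ?_
        rw [abs_mul]
        exact mul_le_mul (norm_le_pi_norm v i) (norm_le_pi_norm w i) (abs_nonneg _)
          (norm_nonneg _)
    _ = _ := by simp

variable {m : ℕ} {γ : ℝ} {ω p : ℝ → Fin m → ℝ} {d : ℝ → ℝ}

theorem hasDerivWithinAt_dotProduct_self_gradient
    (hp : ∀ t, 0 ≤ t → HasDerivWithinAt p (-(γ * (d t + ω t ⬝ᵥ p t)) • ω t) (Ici 0) t)
    (t : ℝ) (ht : 0 ≤ t) :
    HasDerivWithinAt (fun t => p t ⬝ᵥ p t)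
      (-2 * γ * ((d t + ω t ⬝ᵥ p t) * (ω t ⬝ᵥ p t))) (Ici 0) t := by
  refine ((hp t ht).dotProduct (hp t ht)).congr_deriv ?_
  rw [smul_dotProduct, dotProduct_smul, dotProduct_comm (p t), smul_eq_mul]
  ring

/-- The parameter error of a gradient law with exponentially decaying disturbance has a
convergent norm. -/
theorem exists_tendsto_dotProduct_self_gradient (hγ : 0 < γ) (hd : ExpDecaying d)
    (hp : ∀ t, 0 ≤ t → HasDerivWithinAt p (-(γ * (d t + ω t ⬝ᵥ p t)) • ω t) (Ici 0) t) :
    BoundedSignal p ∧ ∃ l, Tendsto (fun t => p t ⬝ᵥ p t) atTop (𝓝 l) := by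
  obtain ⟨K, μ, hμ, hK⟩ := hd
  -- Chosen so that R' = -γK² exp(-2μt) absorbs γd² in (|p|²)' = -γ(d + ωᵀp)² - γ(ωᵀp)² + γd².
  set R : ℝ → ℝ := fun t => γ * K ^ 2 / (2 * μ) * Real.exp (-(2 * μ) * t) with hR
  have hR0 : ∀ t, 0 ≤ R t := fun t => by positivity
  set W : ℝ → ℝ := fun t => p t ⬝ᵥ p t + R t with hW
  have hWd : ∀ t, 0 ≤ t → HasDerivWithinAt W (-2 * γ * ((d t + ω t ⬝ᵥ p t) * (ω t ⬝ᵥ p t)) +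
      -(γ * K ^ 2 * Real.exp (-(2 * μ) * t))) (Ici 0) t := by
    intro t ht
    have h1 : HasDerivAt (fun s : ℝ => -(2 * μ) * s) (-(2 * μ)) t := by
      simpa using (hasDerivAt_id t).const_mul (-(2 * μ))
    have h2 : HasDerivAt R (-(γ * K ^ 2 * Real.exp (-(2 * μ) * t))) t := by
      refine (h1.exp.const_mul (γ * K ^ 2 / (2 * μ))).congr_deriv ?_
      field_simp
    exact (hasDerivWithinAt_dotProduct_self_gradient hp t ht).add h2.hasDerivWithinAt
  have hanti : AntitoneOn W (Ici 0) := by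
    refine antitoneOn_of_hasDerivWithinAt_nonpos (convex_Ici 0)
      (fun t ht => (hWd t ht).continuousWithinAt)
      (fun t ht => (hWd t (interior_subset ht)).mono interior_subset) fun t ht => ?_
    have h1 := hK t (interior_subset ht)
    have h2 : d t ^ 2 ≤ K ^ 2 * Real.exp (-(2 * μ) * t) := by
      have h3 : Real.exp (-(2 * μ) * t) = Real.exp (-μ * t) ^ 2 := by
        rw [← Real.exp_nat_mul]
        ring_nf
      rw [h3, ← mul_pow, ← sq_abs]
      exact pow_le_pow_left₀ (abs_nonneg _) h1 2
    nlinarith [mul_le_mul_of_nonneg_left h2 hγ.le,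
      mul_nonneg hγ.le (sq_nonneg (d t + ω t ⬝ᵥ p t)),
      mul_nonneg hγ.le (sq_nonneg (ω t ⬝ᵥ p t))]
  have hp0 : ∀ t, 0 ≤ p t ⬝ᵥ p t := fun t => dotProduct_self_nonneg_real (p t)
  constructor
  · refine ⟨Real.sqrt (W 0), fun t ht => (pi_norm_le_iff_of_nonneg (Real.sqrt_nonneg _)).2
      fun i => ?_⟩
    rw [Real.norm_eq_abs]
    refine Real.abs_le_sqrt ?_
    have h1 : W t ≤ W 0 := hanti self_mem_Ici ht ht
    have h2 : p t i * p t i ≤ p t ⬝ᵥ p t :=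
      Finset.single_le_sum (f := fun i => p t i * p t i) (fun i _ => mul_self_nonneg _)
        (Finset.mem_univ i)
    have h3 : p t ⬝ᵥ p t + R t ≤ W 0 := h1
    nlinarith [hR0 t]
  · have hm : Antitone fun t => W (max t 0) := fun s t hst =>
      hanti (le_max_right s 0) (le_max_right t 0) (max_le_max_right 0 hst)
    have hbdd : BddBelow (range fun t => W (max t 0)) :=
      ⟨0, by rintro _ ⟨t, rfl⟩; exact add_nonneg (hp0 _) (hR0 _)⟩
    have h1 := tendsto_atTop_ciInf hm hbdd
    have h2 : Tendsto W atTop (𝓝 (⨅ t, W (max t 0))) := by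
      refine h1.congr' ?_
      filter_upwards [eventually_ge_atTop 0] with t ht
      rw [max_eq_left ht]
    have h3 : Tendsto R atTop (𝓝 (γ * K ^ 2 / (2 * μ) * 0)) := by
      refine Tendsto.const_mul _ (Real.tendsto_exp_atBot.comp ?_)
      exact tendsto_id.const_mul_atTop_of_neg (by linarith)
    refine ⟨_, (h2.sub h3).congr fun t => ?_⟩
    simp [hW]

theorem ExpDecaying.tendsto_zero {E : Type*} [NormedAddCommGroup E] {f : ℝ → E}
    (hf : ExpDecaying f) : Tendsto f atTop (𝓝 0) := by
  obtain ⟨M, μ, hμ, hM⟩ := hf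
  have h : Tendsto (fun t => M * Real.exp (-μ * t)) atTop (𝓝 (M * 0)) :=
    (Real.tendsto_exp_atBot.comp (tendsto_id.const_mul_atTop_of_neg (by linarith))).const_mul _
  rw [mul_zero] at h
  refine squeeze_zero_norm' ?_ h
  filter_upwards [eventually_ge_atTop 0] with t ht using hM t ht

theorem ExpDecaying.dotProduct {n : ℕ} (c : Fin n → ℝ) {z : ℝ → Fin n → ℝ}
    (hz : ExpDecaying z) : ExpDecaying fun t => c ⬝ᵥ z t := by
  obtain ⟨M, μ, hμ, hM⟩ := hz
  refine ⟨n * ‖c‖ * M, μ, hμ, fun t ht => ?_⟩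
  calc ‖c ⬝ᵥ z t‖ ≤ n * (‖c‖ * ‖z t‖) := abs_dotProduct_le _ _
    _ ≤ n * (‖c‖ * (M * Real.exp (-μ * t))) := by
        gcongr
        exact hM t ht
    _ = _ := by ring

/-- Barbalat for |p|² yields (d + ωᵀp)ωᵀp → 0; since d → 0 and ωᵀp is bounded, (ωᵀp)² → 0. -/
theorem tendsto_prediction_error_gradient (hγ : 0 < γ) (hd : ExpDecaying d)
    (hdu : BddUniformContinuous d) (hω : BddUniformContinuous ω)
    (hp : ∀ t, 0 ≤ t → HasDerivWithinAt p (-(γ * (d t + ω t ⬝ᵥ p t)) • ω t) (Ici 0) t) :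
    BddUniformContinuous p ∧ Tendsto (fun t => ω t ⬝ᵥ p t) atTop (𝓝 0) := by
  obtain ⟨hpb, l, hl⟩ := exists_tendsto_dotProduct_self_gradient hγ hd hp
  have hpu : BddUniformContinuous p := by
    refine .of_hasDerivWithinAt hpb hp ?_
    exact ((hdu.bounded.prodMk (hω.bounded.prodMk hpb)).comp
      (Φ := fun q : ℝ × (Fin m → ℝ) × (Fin m → ℝ) =>
        -(γ * (q.1 + q.2.1 ⬝ᵥ q.2.2)) • q.2.1) (by fun_prop))
  refine ⟨hpu, ?_⟩
  have hq : BddUniformContinuous fun t => ω t ⬝ᵥ p t :=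
    (hω.prodMk hpu).comp (Φ := fun q : (Fin m → ℝ) × (Fin m → ℝ) => q.1 ⬝ᵥ q.2) (by fun_prop)
  have h1 := tendsto_deriv_zero_of_tendsto (hasDerivWithinAt_dotProduct_self_gradient hp)
    ((hdu.prodMk hq).comp (Φ := fun r : ℝ × ℝ => -2 * γ * ((r.1 + r.2) * r.2))
      (by fun_prop)).uniform hl
  have h2 : Tendsto (fun t => d t * (ω t ⬝ᵥ p t)) atTop (𝓝 0) := by
    obtain ⟨M, hM⟩ := hq.bounded
    refine hd.tendsto_zero.zero_mul_isBoundedUnder_le ⟨M, ?_⟩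
    rw [eventually_map]
    filter_upwards [eventually_ge_atTop 0] with t ht using hM t ht
  have h3 : Tendsto (fun t => (ω t ⬝ᵥ p t) ^ 2) atTop (𝓝 0) := by
    have h4 := (h1.const_mul (-1 / (2 * γ))).sub h2
    rw [mul_zero, sub_zero] at h4
    refine h4.congr fun t => ?_
    field_simp
    ring
  have h5 := (Real.continuous_sqrt.tendsto 0).comp h3
  rw [Real.sqrt_zero] at h5
  rw [tendsto_zero_iff_abs_tendsto_zero]
  refine h5.congr fun t => ?_
  simp [Real.sqrt_sq_eq_abs]

/-- A slowly varying vector whose product with a persistently exciting signal vanishes at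
infinity vanishes itself. -/
theorem PersistentlyExciting.tendsto_dotProduct_self {f p' : ℝ → Fin m → ℝ}
    (hf : PersistentlyExciting f) (hfc : ContinuousOn f (Ici 0))
    (hp : ∀ t, 0 ≤ t → HasDerivWithinAt p (p' t) (Ici 0) t)
    (hp' : Tendsto p' atTop (𝓝 0)) (hfp : Tendsto (fun t => f t ⬝ᵥ p t) atTop (𝓝 0)) :
    Tendsto (fun t => p t ⬝ᵥ p t) atTop (𝓝 0) := by
  obtain ⟨-, ⟨M, hM⟩, α, T, hα, hT, hPE⟩ := hf
  have hM0 : 0 ≤ M := (norm_nonneg _).trans (hM 0 le_rfl)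
  rw [NormedAddGroup.tendsto_nhds_zero] at hp' hfp ⊢
  intro ε hε
  -- δ bounds both ‖p'‖ and |fᵀp| at late times. Freezing p at the window's start costs at most
  -- mMδT, where m comes from bounding a dot product by sup norms.
  obtain ⟨δ, hδ, hδ0⟩ : ∃ δ : ℝ, T * (δ * (1 + m * M * T)) ^ 2 < α * ε ∧ 0 < δ := by
    have h1 : Tendsto (fun δ : ℝ => T * (δ * (1 + m * M * T)) ^ 2) (𝓝[>] 0) (𝓝 0) := by
      have h2 : Continuous fun δ : ℝ => T * (δ * (1 + m * M * T)) ^ 2 := by fun_prop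
      simpa using (h2.tendsto 0).mono_left nhdsWithin_le_nhds
    exact ((h1.eventually (gt_mem_nhds (by positivity))).and self_mem_nhdsWithin).exists
  obtain ⟨t₀, ht₀⟩ := eventually_atTop.1 ((hp' δ hδ0).and (hfp δ hδ0))
  filter_upwards [eventually_ge_atTop (max t₀ 0)] with t ht
  have ht0 : 0 ≤ t := (le_max_right _ _).trans ht
  have htt : t₀ ≤ t := (le_max_left _ _).trans ht
  have hsub : uIcc t (t + T) ⊆ Ici 0 := by
    rw [uIcc_of_le (by linarith)]
    exact fun s hs => ht0.trans hs.1
  have hfi : ∀ i, ContinuousOn (fun s => f s i) (uIcc t (t + T)) := fun i =>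
    (continuousOn_pi.1 hfc i).mono hsub
  have hquad : ∫ s in t..(t + T), (f s ⬝ᵥ p t) ^ 2 =
      p t ⬝ᵥ ((Matrix.of fun i j : Fin m => ∫ s in t..(t + T), f s i * f s j) *ᵥ p t) := by
    have h1 : ∀ s, (f s ⬝ᵥ p t) ^ 2 = ∑ i, ∑ j, p t i * p t j * (f s i * f s j) := by
      intro s
      rw [sq, dotProduct, Finset.sum_mul_sum]
      refine Finset.sum_congr rfl fun i _ => Finset.sum_congr rfl fun j _ => by ring
    have h2 : ∀ i j, IntervalIntegrable (fun s => p t i * p t j * (f s i * f s j))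
        MeasureTheory.volume t (t + T) := fun i j =>
      (((hfi i).mul (hfi j)).const_mul _).intervalIntegrable
    have h3 : ∀ i, IntervalIntegrable (fun s => ∑ j, p t i * p t j * (f s i * f s j))
        MeasureTheory.volume t (t + T) := fun i =>
      (continuousOn_finsetSum _ fun j _ =>
        ((hfi i).mul (hfi j)).const_mul _).intervalIntegrable
    simp only [h1]
    rw [intervalIntegral.integral_finsetSum fun i _ => h3 i]
    simp only [dotProduct, Matrix.mulVec, Matrix.of_apply, Finset.mul_sum]
    refine Finset.sum_congr rfl fun i _ => ?_
    rw [intervalIntegral.integral_finsetSum fun j _ => h2 i j]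
    refine Finset.sum_congr rfl fun j _ => ?_
    rw [intervalIntegral.integral_const_mul]
    ring
  have hlow : α * (p t ⬝ᵥ p t) ≤ ∫ s in t..(t + T), (f s ⬝ᵥ p t) ^ 2 := by
    have h1 := (hPE t ht0).dotProduct_mulVec_nonneg (p t)
    rw [Matrix.sub_mulVec, dotProduct_sub, Matrix.smul_mulVec, Matrix.one_mulVec,
      dotProduct_smul] at h1
    rw [hquad]
    simpa using h1
  have hup : ∫ s in t..(t + T), (f s ⬝ᵥ p t) ^ 2 ≤ T * (δ * (1 + m * M * T)) ^ 2 := by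
    have h1 : ∀ s ∈ Icc t (t + T), (f s ⬝ᵥ p t) ^ 2 ≤ (δ * (1 + m * M * T)) ^ 2 := by
      intro s hs
      have hs0 : 0 ≤ s := ht0.trans hs.1
      have h2 := Convex.norm_image_sub_le_of_norm_hasDerivWithin_le (f := p) (f' := p') (C := δ)
        (s := Icc t (t + T)) (x := s) (y := t)
        (fun r hr => (hp r (ht0.trans hr.1)).mono fun q hq => ht0.trans hq.1)
        (fun r hr => (ht₀ r (htt.trans hr.1)).1.le) (convex_Icc _ _) hs ⟨le_rfl, by linarith⟩
      have h3 : ‖t - s‖ ≤ T := by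
        rw [Real.norm_eq_abs, abs_sub_comm, abs_of_nonneg (by linarith [hs.1])]
        linarith [hs.2]
      have h4 : |f s ⬝ᵥ (p t - p s)| ≤ m * (M * (δ * T)) := by
        refine (abs_dotProduct_le _ _).trans ?_
        gcongr
        · exact hM s hs0
        · exact h2.trans (by gcongr)
      have h5 : |f s ⬝ᵥ p s| ≤ δ := (ht₀ s (htt.trans hs.1)).2.le
      have h6 : f s ⬝ᵥ p t = f s ⬝ᵥ p s + f s ⬝ᵥ (p t - p s) := by
        rw [dotProduct_sub]
        ring
      rw [← sq_abs]
      refine pow_le_pow_left₀ (abs_nonneg _) ?_ 2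
      rw [h6]
      refine (abs_add_le _ _).trans ?_
      linarith
    have hcont : ContinuousOn (fun s => (f s ⬝ᵥ p t) ^ 2) (uIcc t (t + T)) := by
      refine ContinuousOn.pow ?_ 2
      exact continuousOn_finsetSum _ fun i _ => (hfi i).mul continuousOn_const
    have h2 := intervalIntegral.integral_mono_on (μ := MeasureTheory.volume)
      (by linarith) hcont.intervalIntegrable
      (continuousOn_const (c := (δ * (1 + m * M * T)) ^ 2)).intervalIntegrable h1
    simpa using h2
  rw [Real.norm_of_nonneg (dotProduct_self_nonneg_real _)]
  have : α * (p t ⬝ᵥ p t) < α * ε := by linarith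
  exact lt_of_mul_lt_mul_left this hα.le

end Gradient

/-! ### Algebra of filter states and solvability of the component equations. -/

section FilterAlgebra

variable {n m : ℕ} {F : Matrix (Fin n) (Fin n) ℝ} {b : Fin n → ℝ}

/-- Derivative of `∑ θᵢ Ωᵢ` for filter states `Ωᵢ` and time-varying weights. -/
theorem hasDerivWithinAt_sum_smul_filter {f : ℝ → Fin m → ℝ} {Ω : Fin m → ℝ → Fin n → ℝ}
    (hΩ : ∀ i, IsFilterState F b (fun t => f t i) (Ω i)) {θ : ℝ → Fin m → ℝ} {θ' : Fin m → ℝ}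
    {t : ℝ} (ht : 0 ≤ t) (hθ : HasDerivWithinAt θ θ' (Ici 0) t) :
    HasDerivWithinAt (fun t => ∑ i, θ t i • Ω i t)
      (F *ᵥ (∑ i, θ t i • Ω i t) + (f t ⬝ᵥ θ t) • b + ∑ i, θ' i • Ω i t) (Ici 0) t := by
  rw [hasDerivWithinAt_pi] at hθ
  have h := HasDerivWithinAt.fun_sum (u := Finset.univ) fun i _ => (hθ i).smul (hΩ i t ht)
  refine h.congr_deriv ?_
  rw [Matrix.mulVec_sum, dotProduct, Finset.sum_smul, ← Finset.sum_add_distrib,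
    ← Finset.sum_add_distrib]
  refine Finset.sum_congr rfl fun i _ => ?_
  rw [Matrix.mulVec_smul, smul_add, smul_smul, mul_comm (f t i)]

theorem dotProduct_sum_smul (c : Fin n → ℝ) (θ : Fin m → ℝ) (Ω : Fin m → Fin n → ℝ) :
    c ⬝ᵥ (∑ i, θ i • Ω i) = (fun i => c ⬝ᵥ Ω i) ⬝ᵥ θ := by
  rw [dotProduct_sum, dotProduct]
  exact Finset.sum_congr rfl fun i _ => by rw [dotProduct_smul, smul_eq_mul, mul_comm]

theorem Plant.F_mulVec (P : Plant n m) (k v : Fin n → ℝ) :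
    P.F k *ᵥ v = P.A *ᵥ v - (P.c ⬝ᵥ v) • k := by
  rw [Plant.F, Matrix.sub_mulVec, Matrix.vecMulVec_mulVec]
  simp

/-- The state is bounded by stability, hence so is its derivative; the input itself need not be
uniformly continuous. -/
theorem IsFilterState.bddUniformContinuous (hF : IsHurwitz F) {u : ℝ → ℝ}
    {z : ℝ → Fin n → ℝ} (hz : IsFilterState F b u z) (hu : BoundedSignal u) :
    BddUniformContinuous z := by
  have hb : BoundedSignal z := hF.boundedSignal hz
    (hu.comp (Φ := fun r : ℝ => r • b) (by fun_prop))
  exact .of_hasDerivWithinAt hb hz ((hb.prodMk hu).comp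
    (Φ := fun q : (Fin n → ℝ) × ℝ => F *ᵥ q.1 + q.2 • b) (by fun_prop))

theorem exists_isFilterState (F : Matrix (Fin n) (Fin n) ℝ) (b : Fin n → ℝ) {u : ℝ → ℝ}
    (hu : BoundedSignal u) (huc : ContinuousOn u (Ici 0)) (z₀ : Fin n → ℝ) :
    ∃ z, IsFilterState F b u z ∧ z 0 = z₀ := by
  obtain ⟨z, hz0, hz⟩ := exists_solution_linear (Matrix.mulVecLin F).toContinuousLinearMap
    (g := fun t => u t • b) (huc.smul continuousOn_const)
    (hu.comp (Φ := fun r : ℝ => r • b) (by fun_prop)) z₀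
  exact ⟨z, fun t ht => by simpa using hz t ht, hz0⟩

theorem Plant.IsMasterSolution.bddUniformContinuous {P : Plant n m} (hφ₀ : Continuous P.φ₀)
    (hφ : Continuous P.φ) {θ : Fin m → ℝ} {x : ℝ → Fin n → ℝ} (hx : P.IsMasterSolution θ x)
    (hb : BoundedSignal x) : BddUniformContinuous x :=
  .of_hasDerivWithinAt hb hx (hb.comp
    (Φ := fun x => P.A *ᵥ x + P.φ₀ (P.c ⬝ᵥ x) + (P.φ (P.c ⬝ᵥ x) ⬝ᵥ θ) • P.b) (by fun_prop))

/-- Global solutions of the gradient law. -/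
theorem exists_gradient_solution {γ : ℝ} {ω : ℝ → Fin m → ℝ} {d : ℝ → ℝ}
    (hω : BddUniformContinuous ω) (hd : BddUniformContinuous d) (p₀ : Fin m → ℝ) :
    ∃ p : ℝ → Fin m → ℝ, p 0 = p₀ ∧
      ∀ t, 0 ≤ t → HasDerivWithinAt p (-(γ * (d t + ω t ⬝ᵥ p t)) • ω t) (Ici 0) t := by
  obtain ⟨M, hM⟩ := hω.bounded
  obtain ⟨B, hB⟩ := (hω.bounded.prodMk hd.bounded).comp
    (Φ := fun q : (Fin m → ℝ) × ℝ => -(γ * (q.2 + q.1 ⬝ᵥ 0)) • q.1) (by fun_prop)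
  have hM0 : 0 ≤ M := (norm_nonneg _).trans (hM 0 le_rfl)
  have hωc : ContinuousOn (fun q : ℝ × (Fin m → ℝ) => ω q.1) (Ici 0 ×ˢ univ) :=
    hω.uniform.continuousOn.comp continuousOn_fst fun q hq => hq.1
  have hdc : ContinuousOn (fun q : ℝ × (Fin m → ℝ) => d q.1) (Ici 0 ×ˢ univ) :=
    hd.uniform.continuousOn.comp continuousOn_fst fun q hq => hq.1
  refine exists_solution_of_lipschitz_Ici (f := fun t v => -(γ * (d t + ω t ⬝ᵥ v)) • ω t)
    (K := Real.toNNReal (|γ| * (m * M * M))) ?_ (fun t ht => ?_) hB p₀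
  · have h1 : Continuous fun q : (Fin m → ℝ) × ℝ × (Fin m → ℝ) =>
        -(γ * (q.2.1 + q.1 ⬝ᵥ q.2.2)) • q.1 := by fun_prop
    exact h1.comp_continuousOn (hωc.prodMk (hdc.prodMk continuousOn_snd))
  · refine LipschitzWith.of_dist_le_mul fun v w => ?_
    rw [dist_eq_norm, dist_eq_norm, Real.coe_toNNReal _ (by positivity)]
    have h1 : -(γ * (d t + ω t ⬝ᵥ v)) • ω t - -(γ * (d t + ω t ⬝ᵥ w)) • ω t =
        -(γ * (ω t ⬝ᵥ (v - w))) • ω t := by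
      rw [← sub_smul, dotProduct_sub]
      ring_nf
    rw [h1, norm_smul, norm_neg, norm_mul, Real.norm_eq_abs, Real.norm_eq_abs]
    calc _ ≤ |γ| * (m * (M * ‖v - w‖)) * M := by
          gcongr
          · refine (abs_dotProduct_le _ _).trans ?_
            gcongr
            exact hM t ht
          · exact hM t ht
      _ = _ := by ring

end FilterAlgebra

/-! ### Error equations, convergence and existence for the closed loop. -/

namespace Signals

variable {n m : ℕ} {P : Plant n m} {k : Fin n → ℝ} {γ : ℝ} {θ : Fin m → ℝ} {S : Signals n m}

/-- The observation error is the state of the filter `H` driven by `φᵀ (θ - θhat)`. -/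
theorem IsClosedLoop.isFilterState_error (h : S.IsClosedLoop P k γ θ) :
    IsFilterState (P.F k) P.b (fun t => S.regressor P t ⬝ᵥ (θ - S.θhat t))
      (fun t => S.x t - S.xhat t) := by
  intro t ht
  refine ((h.master t ht).sub (h.observer t ht)).congr_deriv ?_
  simp only [P.F_mulVec, Matrix.mulVec_sub, dotProduct_sub, sub_smul, y, yhat, regressor]
  abel

/-- The mismatch between the augmented error model and its regression form. -/
def mismatch (S : Signals n m) (θ : Fin m → ℝ) (t : ℝ) : Fin n → ℝ :=
  S.x t - S.xhat t + S.ζ t - ∑ i, θ i • S.Ω i t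

/-- The inputs φᵀ(θ - θhat), φᵀθhat and -φᵀθ add up to zero; constancy of θ leaves no swapping term.
-/
theorem IsClosedLoop.hasDerivWithinAt_mismatch (h : S.IsClosedLoop P k γ θ) (t : ℝ)
    (ht : 0 ≤ t) :
    HasDerivWithinAt (S.mismatch θ) (P.F k *ᵥ S.mismatch θ t) (Ici 0) t := by
  have h1 := hasDerivWithinAt_sum_smul_filter h.filterΩ ht
    (hasDerivWithinAt_const t (Ici 0) θ)
  refine (((h.isFilterState_error t ht).add (h.filterζ t ht)).sub h1).congr_deriv ?_
  simp only [mismatch, Matrix.mulVec_add, Matrix.mulVec_sub, dotProduct_sub, sub_smul,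
    Pi.zero_apply, zero_smul, Finset.sum_const_zero]
  abel

theorem ω_eq (S : Signals n m) (P : Plant n m) (t : ℝ) :
    S.ω P t = fun i => P.c ⬝ᵥ S.Ω i t := rfl

theorem ehat_eq (S : Signals n m) (P : Plant n m) (θ : Fin m → ℝ) (t : ℝ) :
    S.ehat P t = P.c ⬝ᵥ S.mismatch θ t + S.ω P t ⬝ᵥ (θ - S.θhat t) := by
  simp only [ehat, e, y, yhat, χ, mismatch, dotProduct_add, dotProduct_sub,
    dotProduct_sum_smul, ω_eq]
  ring

theorem IsClosedLoop.hasDerivWithinAt_parameter_error (h : S.IsClosedLoop P k γ θ) (t : ℝ)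
    (ht : 0 ≤ t) :
    HasDerivWithinAt (fun t => θ - S.θhat t)
      (-(γ * (P.c ⬝ᵥ S.mismatch θ t + S.ω P t ⬝ᵥ (θ - S.θhat t))) • S.ω P t) (Ici 0) t := by
  rw [← ehat_eq, neg_smul]
  exact (h.adaptation t ht).const_sub θ

theorem IsClosedLoop.bddUniformContinuous_regressor (hφ₀ : Continuous P.φ₀)
    (hφ : Continuous P.φ) (hP : P.HasBoundedStates) (h : S.IsClosedLoop P k γ θ) :
    BddUniformContinuous (S.regressor P) :=
  (h.master.bddUniformContinuous hφ₀ hφ ((hP θ (S.x 0)).2 S.x h.master rfl)).comp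
    (Φ := fun x => P.φ (P.c ⬝ᵥ x)) (by fun_prop)

theorem IsClosedLoop.bddUniformContinuous_Ω (hF : IsHurwitz (P.F k))
    (h : S.IsClosedLoop P k γ θ) (hreg : BoundedSignal (S.regressor P)) :
    BddUniformContinuous fun t i => S.Ω i t :=
  .pi fun i => (h.filterΩ i).bddUniformContinuous hF
    (hreg.comp (Φ := fun v : Fin m → ℝ => v i) (by fun_prop))

theorem IsClosedLoop.adaptation_properties (hF : IsHurwitz (P.F k)) (hγ : 0 < γ)
    (h : S.IsClosedLoop P k γ θ) (hreg : BoundedSignal (S.regressor P)) :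
    BddUniformContinuous (fun t => θ - S.θhat t) ∧ Tendsto (S.ehat P) atTop (𝓝 0) ∧
      BddUniformContinuous (S.ω P) := by
  have hΩ := h.bddUniformContinuous_Ω hF hreg
  have hω : BddUniformContinuous (S.ω P) :=
    hΩ.comp (Φ := fun Ω : Fin m → Fin n → ℝ => fun i => P.c ⬝ᵥ Ω i) (by fun_prop)
  have hm : IsFilterState (P.F k) P.b (fun _ => 0) (S.mismatch θ) := fun t ht => by
    simpa using h.hasDerivWithinAt_mismatch t ht
  have hd := (hF.expDecaying h.hasDerivWithinAt_mismatch).dotProduct P.c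
  have hdu := (hm.bddUniformContinuous hF ⟨0, by simp⟩).comp
    (Φ := fun v => P.c ⬝ᵥ v) (by fun_prop)
  obtain ⟨h1, h2⟩ := tendsto_prediction_error_gradient hγ hd hdu hω
    h.hasDerivWithinAt_parameter_error
  refine ⟨h1, ?_, hω⟩
  have h3 := hd.tendsto_zero.add h2
  rw [add_zero] at h3
  exact h3.congr fun t => (S.ehat_eq P θ t).symm

theorem IsClosedLoop.tendsto_adaptation_rate (hF : IsHurwitz (P.F k)) (hγ : 0 < γ)
    (h : S.IsClosedLoop P k γ θ) (hreg : BoundedSignal (S.regressor P)) :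
    Tendsto (fun t => (γ * S.ehat P t) • S.ω P t) atTop (𝓝 0) := by
  obtain ⟨-, he, hω⟩ := h.adaptation_properties hF hγ hreg
  obtain ⟨M, hM⟩ := hω.bounded
  have h1 : Tendsto (fun t => γ * S.ehat P t) atTop (𝓝 0) := by
    simpa using he.const_mul γ
  refine h1.zero_smul_isBoundedUnder_le ⟨M, ?_⟩
  rw [eventually_map]
  filter_upwards [eventually_ge_atTop 0] with t ht using hM t ht

/-- Swapping argument: ζ - Σ θhatᵢ Ωᵢ is a stable filter state driven by -Σ θhat'ᵢ Ωᵢ → 0, and its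
output is exactly ê - e. -/
theorem IsClosedLoop.tendsto_output_error (hF : IsHurwitz (P.F k)) (hγ : 0 < γ)
    (h : S.IsClosedLoop P k γ θ) (hreg : BoundedSignal (S.regressor P)) :
    Tendsto (S.e P) atTop (𝓝 0) := by
  set θ' : ℝ → Fin m → ℝ := fun t => (γ * S.ehat P t) • S.ω P t
  have hrate := h.tendsto_adaptation_rate hF hγ hreg
  have hΩ := h.bddUniformContinuous_Ω hF hreg
  have hin : Tendsto (fun t => -∑ i, θ' t i • S.Ω i t) atTop (𝓝 0) := by
    have h1 : Tendsto (fun t => ∑ i, θ' t i • S.Ω i t) atTop (𝓝 (∑ _i : Fin m, 0)) := by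
      refine tendsto_finsetSum _ fun i _ => ?_
      obtain ⟨M, hM⟩ := hΩ.bounded
      refine (tendsto_pi_nhds.1 hrate i).zero_smul_isBoundedUnder_le ⟨M, ?_⟩
      rw [eventually_map]
      filter_upwards [eventually_ge_atTop 0] with t ht
      exact (norm_le_pi_norm (fun i => S.Ω i t) i).trans (hM t ht)
    simpa using h1.neg
  have hη : Tendsto (fun t => S.ζ t - ∑ i, S.θhat t i • S.Ω i t) atTop (𝓝 0) := by
    refine hF.tendsto_zero (fun t ht => ?_) hin
    have h1 := hasDerivWithinAt_sum_smul_filter h.filterΩ ht (h.adaptation t ht)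
    refine ((h.filterζ t ht).sub h1).congr_deriv ?_
    rw [Matrix.mulVec_sub]
    abel
  have hcη : Tendsto (fun t => P.c ⬝ᵥ (S.ζ t - ∑ i, S.θhat t i • S.Ω i t)) atTop (𝓝 0) := by
    have hc : Continuous fun v => P.c ⬝ᵥ v := by fun_prop
    simpa [Function.comp_def] using (hc.tendsto 0).comp hη
  have h2 := (h.adaptation_properties hF hγ hreg).2.1.sub hcη
  rw [sub_zero] at h2
  refine h2.congr fun t => ?_
  simp only [ehat, χ, ω_eq, dotProduct_sub, dotProduct_sum_smul]
  ring

theorem IsClosedLoop.allBounded (hφ₀ : Continuous P.φ₀) (hφ : Continuous P.φ)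
    (hP : P.HasBoundedStates) (hF : IsHurwitz (P.F k)) (hγ : 0 < γ)
    (h : S.IsClosedLoop P k γ θ) : S.AllBounded P := by
  have hreg := (h.bddUniformContinuous_regressor hφ₀ hφ hP).bounded
  have hx : BoundedSignal S.x := (hP θ (S.x 0)).2 S.x h.master rfl
  have hp := (h.adaptation_properties hF hγ hreg).1.bounded
  have hθ : BoundedSignal S.θhat := by
    simpa using hp.comp (Φ := fun v => θ - v) (by fun_prop)
  have hΩ := (h.bddUniformContinuous_Ω hF hreg).bounded
  have hζ : BoundedSignal S.ζ := (h.filterζ.bddUniformContinuous hF ((hreg.prodMk hθ).comp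
    (Φ := fun q : (Fin m → ℝ) × (Fin m → ℝ) => q.1 ⬝ᵥ q.2) (by fun_prop))).bounded
  have hε := (h.isFilterState_error.bddUniformContinuous hF ((hreg.prodMk hp).comp
    (Φ := fun q : (Fin m → ℝ) × (Fin m → ℝ) => q.1 ⬝ᵥ q.2) (by fun_prop))).bounded
  have hxhat : BoundedSignal S.xhat := by
    simpa using (hx.prodMk hε).comp (Φ := fun q => q.1 - q.2) (by fun_prop)
  have hy : BoundedSignal (S.y P) := hx.comp (Φ := fun x => P.c ⬝ᵥ x) (by fun_prop)
  have hyhat : BoundedSignal (S.yhat P) := hxhat.comp (Φ := fun x => P.c ⬝ᵥ x) (by fun_prop)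
  have he : BoundedSignal (S.e P) :=
    (hy.prodMk hyhat).comp (Φ := fun q : ℝ × ℝ => q.1 - q.2) (by fun_prop)
  have hχ : BoundedSignal (S.χ P) := hζ.comp (Φ := fun x => P.c ⬝ᵥ x) (by fun_prop)
  have hω : BoundedSignal (S.ω P) :=
    hΩ.comp (Φ := fun (Ω : Fin m → Fin n → ℝ) i => P.c ⬝ᵥ Ω i) (by fun_prop)
  exact {
    x := hx
    xhat := hxhat
    θhat := hθ
    Ω := fun i => hΩ.comp (Φ := fun Ω : Fin m → Fin n → ℝ => Ω i) (by fun_prop)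
    ζ := hζ
    y := hy
    yhat := hyhat
    e := he
    φ₀ := hy.comp hφ₀
    regressor := hreg
    ω := hω
    χ := hχ
    ehat := (he.prodMk (hχ.prodMk (hω.prodMk hθ))).comp
      (Φ := fun q : ℝ × ℝ × (Fin m → ℝ) × (Fin m → ℝ) => q.1 + q.2.1 - q.2.2.1 ⬝ᵥ q.2.2.2)
      (by fun_prop) }

theorem IsClosedLoop.tendsto_parameter_error (hφ₀ : Continuous P.φ₀) (hφ : Continuous P.φ)
    (hP : P.HasBoundedStates) (hF : IsHurwitz (P.F k)) (hγ : 0 < γ)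
    (h : S.IsClosedLoop P k γ θ) (hPE : PersistentlyExciting (S.regressor P))
    (hH : IsMinimumPhase (P.F k) P.b P.c) :
    Tendsto (fun t => ‖WithLp.toLp 2 (θ - S.θhat t)‖) atTop (𝓝 0) := by
  have hreg := h.bddUniformContinuous_regressor hφ₀ hφ hP
  have hp := (h.adaptation_properties hF hγ hreg.bounded).1
  have hout := h.tendsto_output_error hF hγ hreg.bounded
  have hu : BddUniformContinuous fun t => S.regressor P t ⬝ᵥ (θ - S.θhat t) :=
    (hreg.prodMk hp).comp (Φ := fun q : (Fin m → ℝ) × (Fin m → ℝ) => q.1 ⬝ᵥ q.2) (by fun_prop)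
  have hin := tendsto_input_of_tendsto_output hF hH hu h.isFilterState_error
    (hout.congr fun t => by simp [e, y, yhat, dotProduct_sub])
  have hrate : Tendsto (fun t => -((γ * S.ehat P t) • S.ω P t)) atTop (𝓝 0) := by
    simpa using (h.tendsto_adaptation_rate hF hγ hreg.bounded).neg
  have hsq := hPE.tendsto_dotProduct_self hreg.uniform.continuousOn
    (fun t ht => (h.adaptation t ht).const_sub θ) hrate hin
  have hsqrt := (Real.continuous_sqrt.tendsto 0).comp hsq
  rw [Real.sqrt_zero] at hsqrt
  refine hsqrt.congr fun t => ?_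
  simp [EuclideanSpace.norm_eq, dotProduct, sq]

theorem exists_isClosedLoop (hφ₀ : Continuous P.φ₀) (hφ : Continuous P.φ)
    (hP : P.HasBoundedStates) (hF : IsHurwitz (P.F k)) (hγ : 0 < γ) (θ : Fin m → ℝ)
    (x₀ xhat₀ : Fin n → ℝ) (θhat₀ : Fin m → ℝ) (Ω₀ : Fin m → Fin n → ℝ) (ζ₀ : Fin n → ℝ) :
    ∃ S : Signals n m, S.IsClosedLoop P k γ θ ∧ S.x 0 = x₀ ∧ S.xhat 0 = xhat₀ ∧
      S.θhat 0 = θhat₀ ∧ (∀ i, S.Ω i 0 = Ω₀ i) ∧ S.ζ 0 = ζ₀ := by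
  obtain ⟨⟨x, hx, hx0⟩, hxb⟩ := hP θ x₀
  have hxu := hx.bddUniformContinuous hφ₀ hφ (hxb x hx hx0)
  have hreg : BddUniformContinuous fun t => P.φ (P.c ⬝ᵥ x t) :=
    hxu.comp (Φ := fun x => P.φ (P.c ⬝ᵥ x)) (by fun_prop)
  have hregi : ∀ i, BddUniformContinuous fun t => P.φ (P.c ⬝ᵥ x t) i := fun i =>
    hreg.comp (Φ := fun v => v i) (by fun_prop)
  choose Ω hΩ hΩ0 using fun i => exists_isFilterState (P.F k) P.b (hregi i).bounded
    (hregi i).uniform.continuousOn (Ω₀ i)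
  -- δ is the future mismatch; its initial value is the one dictated by the prescribed data.
  obtain ⟨δ, hδ, hδ0⟩ := exists_isFilterState (P.F k) P.b (u := fun _ => 0) ⟨0, by simp⟩
    continuousOn_const (x₀ - xhat₀ + ζ₀ - ∑ i, θ i • Ω₀ i)
  have hδ' : ∀ t, 0 ≤ t → HasDerivWithinAt δ (P.F k *ᵥ δ t) (Ici 0) t := fun t ht => by
    simpa using hδ t ht
  have hω : BddUniformContinuous fun t i => P.c ⬝ᵥ Ω i t :=
    .pi fun i => ((hΩ i).bddUniformContinuous hF (hregi i).bounded).comp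
      (Φ := fun v => P.c ⬝ᵥ v) (by fun_prop)
  have hd : BddUniformContinuous fun t => P.c ⬝ᵥ δ t :=
    (hδ.bddUniformContinuous hF ⟨0, by simp⟩).comp (Φ := fun v => P.c ⬝ᵥ v) (by fun_prop)
  have hde := (hF.expDecaying hδ').dotProduct P.c
  obtain ⟨p, hp0, hp⟩ := exists_gradient_solution (γ := γ) hω hd (θ - θhat₀)
  have hpu := (tendsto_prediction_error_gradient hγ hde hd hω hp).1
  have hin : BddUniformContinuous fun t => P.φ (P.c ⬝ᵥ x t) ⬝ᵥ (θ - p t) :=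
    (hreg.prodMk hpu).comp (Φ := fun q : (Fin m → ℝ) × (Fin m → ℝ) => q.1 ⬝ᵥ (θ - q.2))
      (by fun_prop)
  obtain ⟨ζ, hζ, hζ0⟩ := exists_isFilterState (P.F k) P.b hin.bounded
    hin.uniform.continuousOn ζ₀
  let S : Signals n m :=
    { x := x
      -- The defining relation of the mismatch, solved for x̂; the observer equation then follows
      -- from those of x, δ, ζ and Ω.
      xhat := fun t => x t - (δ t - ζ t + ∑ i, θ i • Ω i t)
      θhat := fun t => θ - p t
      Ω := Ω
      ζ := ζ }
  have hmis : ∀ t, S.mismatch θ t = δ t := fun t => by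
    simp only [S, mismatch]
    abel
  refine ⟨S, ⟨hx, fun t ht => ?_, hΩ, hζ, fun t ht => ?_⟩, hx0, ?_, ?_, hΩ0, hζ0⟩
  · have h1 := hasDerivWithinAt_sum_smul_filter hΩ ht (hasDerivWithinAt_const t (Ici 0) θ)
    refine ((hx t ht).sub (((hδ' t ht).sub (hζ t ht)).add h1)).congr_deriv ?_
    simp only [S, y, yhat, P.F_mulVec, Matrix.mulVec_add, Matrix.mulVec_sub, dotProduct_sub,
      dotProduct_add, sub_smul, add_smul, Pi.zero_apply, zero_smul, Finset.sum_const_zero]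
    abel
  · refine ((hp t ht).const_sub θ).congr_deriv ?_
    rw [S.ehat_eq P θ, hmis, ← neg_smul, neg_neg]
    simp [S, ω_eq]
  · simp only [S]
    rw [hx0, hδ0, hζ0]
    simp only [hΩ0]
    abel
  · simp [S, hp0]

end Signals

theorem theorem1 {n m : ℕ} (P : Plant n m)
    (hφ₀ : Continuous P.φ₀) (hφ : Continuous P.φ)
    (hP : P.HasBoundedStates)
    (k : Fin n → ℝ) (hF : IsHurwitz (P.F k)) :
    ∀ (γ : ℝ), 0 < γ → ∀ θ : Fin m → ℝ,
      -- from all initial conditions the closed loop has a solution on the whole of `[0, ∞)`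
      (∀ (x₀ xhat₀ : Fin n → ℝ) (θhat₀ : Fin m → ℝ) (Ω₀ : Fin m → Fin n → ℝ) (ζ₀ : Fin n → ℝ),
        ∃ S : Signals n m, S.IsClosedLoop P k γ θ ∧ S.x 0 = x₀ ∧ S.xhat 0 = xhat₀ ∧
          S.θhat 0 = θhat₀ ∧ (∀ i, S.Ω i 0 = Ω₀ i) ∧ S.ζ 0 = ζ₀) ∧
      -- and every solution, whatever its initial conditions, has properties (i) and (ii)
      ∀ S : Signals n m, S.IsClosedLoop P k γ θ →
        (S.AllBounded P ∧ Tendsto (fun t => S.y P t - S.yhat P t) atTop (𝓝 0)) ∧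
        (PersistentlyExciting (S.regressor P) → IsMinimumPhase (P.F k) P.b P.c →
          Tendsto (fun t => ‖WithLp.toLp 2 (θ - S.θhat t)‖) atTop (𝓝 0)) := by

  intro γ hγ θ
  refine ⟨Signals.exists_isClosedLoop hφ₀ hφ hP hF hγ θ, fun S h => ⟨⟨?_, ?_⟩, ?_⟩⟩
  · exact h.allBounded hφ₀ hφ hP hF hγ
  · exact h.tendsto_output_error hF hγ (h.bddUniformContinuous_regressor hφ₀ hφ hP).bounded
  · exact h.tendsto_parameter_error hφ₀ hφ hP hF hγ
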